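/- Let $N\ge 2$. Write $\widehat f(\xi)=\int_{\mathbb R^N} f(x)e^{-ix\cdot\xi}\,dx$ for the Fourier transform, extended as usual to $L^2(\mathbb R^N)$ and to tempered distributions. Fix a real-valued $\chi\in C^\infty(\mathbb R)$ with $\chi(t)=1$ for $|t|<1$ and $\chi(t)=0$ for $|t|>2$, and set $\chi_n(x)=\chi(|x|/n)$ for $x\in\mathbb R^N$, $n\ge 1$. Let $W$ be a real-valued even tempered distribution on $\mathbb R^N$ such that $W\in\mathcal M_{2,2}(\mathbb R^N)$, that is, $g\mapsto W*g$ is a bounded linear operator from $L^2(\mathbb R^N)$ to $L^2(\mathbb R^N)$. Assume that $\widehat W$ is (represented by) a function that is differentiable almost everywhere, that its almost everywhere defined partial derivatives $\partial_k\widehat W$ are also its weak (distributional) derivatives, and that for all $j,k\in\{1,\dots,N\}$ the map $\xi\mapsto \xi_j\,\partial_k\widehat W(\xi)$ is bounded and continuous almost everywhere on $\mathbb R^N$ (that is, it agrees a.e. with a bounded function that is continuous at almost every point). Let $f\in L^2(\mathbb R^N)\cap H^1_{\mathrm{loc}}(\mathbb R^N)$ be real-valued. Then, for every $j\in\{1,\dots,N\}$,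 all the integrals below converge absolutely and $$\lim_{n\to\infty}\; -\frac12\int_{\mathbb R^N}(W*f)\,x_j\,\chi_n\,\partial_j f\,dx \;=\; \frac14\int_{\mathbb R^N}(W*f)\,f\,dx\;-\;\frac1{4(2\pi)^N}\int_{\mathbb R^N}\xi_j\,\partial_j\widehat W(\xi)\,|\widehat f(\xi)|^2\,d\xi .$$ -/

import Mathlib

open MeasureTheory Filter Topology
open scoped SchwartzMap FourierTransform ENNReal ContDiff

noncomputable section

namespace Pohozaev

/-- The Euclidean space `ℝ^N`. -/
abbrev Eu (N : ℕ) : Type := EuclideanSpace ℝ (Fin N)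

variable {N : ℕ}

/-- The complex Hilbert space `L²(ℝ^N; ℂ)`. -/
abbrev L2 (N : ℕ) : Type := Lp (α := Eu N) ℂ 2 volume

/-- The `k`-th vector of the canonical basis of `ℝ^N`. -/
def e (k : Fin N) : Eu N := EuclideanSpace.single k 1

/-! ### Weak derivatives and local Sobolev functions -/

/-- `g` is the weak (distributional) partial derivative `∂_k u`:
both are locally integrable and `∫ u ∂_k φ = - ∫ g φ` for every `φ ∈ C_c^∞(ℝ^N)`. -/
structure IsWeakPartialDeriv {F : Type*} [NormedAddCommGroup F] [NormedSpace ℝ F]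
    (k : Fin N) (u g : Eu N → F) : Prop where
  locallyIntegrable : LocallyIntegrable u volume
  locallyIntegrable_deriv : LocallyIntegrable g volume
  integral_eq : ∀ φ : Eu N → ℝ, ContDiff ℝ ∞ φ → HasCompactSupport φ →
    ∫ x, (fderiv ℝ φ x (e k)) • u x = - ∫ x, φ x • g x

/-- `u ∈ L²_loc(ℝ^N)`. -/
def MemL2Loc (u : Eu N → ℝ) : Prop :=
  ∀ K : Set (Eu N), IsCompact K → MemLp u 2 (volume.restrict K)

/-- `u ∈ H¹_loc(ℝ^N)`. -/
def MemH1Loc (u : Eu N → ℝ) : Prop :=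
  MemL2Loc u ∧ ∀ k : Fin N, ∃ g : Eu N → ℝ, IsWeakPartialDeriv k u g ∧ MemL2Loc g

/-! ### The Fourier transform `∫ f(x) e^{-i x·ξ} dx`

Mathlib's `𝓕 f` is `∫ f(x) e^{-2π i x·ξ} dx`, so that the Fourier transform used here is
`ξ ↦ 𝓕 f (ξ / (2π))`. -/

/-- The dilation `ξ ↦ ξ / (2π)`. -/
def dilation (N : ℕ) : Eu N ≃L[ℝ] Eu N :=
  ContinuousLinearEquiv.smulLeft (Units.mk0 ((2 * Real.pi)⁻¹ : ℝ) (by positivity))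

/-- `φ̂(ξ) = ∫ φ(x) e^{-i x·ξ} dx` for a Schwartz function `φ`. -/
def fourierSchwartz (φ : 𝓢(Eu N, ℂ)) : 𝓢(Eu N, ℂ) :=
  SchwartzMap.compCLMOfContinuousLinearEquiv ℂ (dilation N) (𝓕 φ)

theorem fourierSchwartz_apply (φ : 𝓢(Eu N, ℂ)) (ξ : Eu N) :
    fourierSchwartz φ ξ = ∫ x : Eu N, Complex.exp (-Complex.I * (inner ℝ x ξ : ℝ)) * φ x := by
  have h : fourierSchwartz φ ξ = 𝓕 (φ : Eu N → ℂ) ((2 * Real.pi)⁻¹ • ξ) := by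
    rw [← SchwartzMap.fourier_coe φ]
    rfl
  rw [h, Real.fourier_eq']
  congr 1 with x
  simp only [inner_smul_right, smul_eq_mul]
  congr 2
  have hpi : (Real.pi : ℂ) ≠ 0 := by exact_mod_cast Real.pi_ne_zero
  push_cast
  field_simp

/-- `f̂` for `f ∈ L²(ℝ^N)`: the extension of `fourierSchwartz` by density. -/
def fourierL2 (f : L2 N) (ξ : Eu N) : ℂ :=
  (𝓕 f : L2 N) ((2 * Real.pi)⁻¹ • ξ)

/-! ### Tempered distributions -/

/-- `W` is real-valued: it takes real values at real-valued Schwartz functions. -/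
def IsReal (W : 𝓢'(Eu N, ℂ)) : Prop :=
  ∀ φ : 𝓢(Eu N, ℂ), (∀ x, (φ x).im = 0) → (W φ).im = 0

/-- `W` is even: it is invariant under `x ↦ -x`. -/
def IsEven (W : 𝓢'(Eu N, ℂ)) : Prop :=
  ∀ φ ψ : 𝓢(Eu N, ℂ), (∀ x, ψ x = φ (-x)) → W ψ = W φ

/-- The Fourier transform `Ŵ`, that is the tempered distribution with `⟨Ŵ, φ⟩ = ⟨W, φ̂⟩`,
is the function `w`. -/
def IsFourierTransform (W : 𝓢'(Eu N, ℂ)) (w : Eu N → ℂ) : Prop :=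
  LocallyIntegrable w volume ∧
    ∀ φ : 𝓢(Eu N, ℂ), Integrable (fun ξ => w ξ * φ ξ) ∧ W (fourierSchwartz φ) = ∫ ξ, w ξ * φ ξ

/-- The Schwartz function `y ↦ φ (x - y)`. -/
def reflectTranslate (φ : 𝓢(Eu N, ℂ)) (x : Eu N) : 𝓢(Eu N, ℂ) :=
  SchwartzMap.compSubConstCLM ℂ x
    (SchwartzMap.compCLMOfContinuousLinearEquiv ℂ (ContinuousLinearEquiv.neg ℝ) φ)

theorem reflectTranslate_apply (φ : 𝓢(Eu N, ℂ)) (x y : Eu N) :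
    reflectTranslate φ x y = φ (x - y) := by
  simp [reflectTranslate]

/-- The convolution `W * φ` of a tempered distribution with a Schwartz function:
`(W * φ)(x) = ⟨W, φ(x - ·)⟩`. -/
def convSchwartz (W : 𝓢'(Eu N, ℂ)) (φ : 𝓢(Eu N, ℂ)) (x : Eu N) : ℂ :=
  W (reflectTranslate φ x)

/-- `W ∈ M_{2,2}(ℝ^N)`: the operator `φ ↦ W * φ` is (extends to) a bounded linear operator
from `L²` to `L²`. -/
def MemM22 (W : 𝓢'(Eu N, ℂ)) : Prop :=
  ∃ T : L2 N →L[ℂ] L2 N,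
    ∀ φ : 𝓢(Eu N, ℂ), T (φ.toLp 2) =ᵐ[volume] convSchwartz W φ

/-- For `W ∈ M_{2,2}`, the bounded operator `f ↦ W * f` of `L²(ℝ^N)`. -/
def convL2 {W : 𝓢'(Eu N, ℂ)} (hW : MemM22 W) :
    L2 N →L[ℂ] L2 N :=
  hW.choose

theorem convL2_toLp {W : 𝓢'(Eu N, ℂ)} (hW : MemM22 W) (φ : 𝓢(Eu N, ℂ)) :
    convL2 hW (φ.toLp 2) =ᵐ[volume] convSchwartz W φ :=
  hW.choose_spec φ

theorem convL2_unique {W : 𝓢'(Eu N, ℂ)} (hW : MemM22 W)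
    (T : L2 N →L[ℂ] L2 N)
    (hT : ∀ φ : 𝓢(Eu N, ℂ), T (φ.toLp 2) =ᵐ[volume] convSchwartz W φ) :
    T = convL2 hW := by
  refine ContinuousLinearMap.coeFn_injective ?_
  refine (SchwartzMap.denseRange_toLpCLM (E := Eu N) (F := ℂ) (μ := volume) (p := 2)
    ENNReal.ofNat_ne_top).equalizer T.continuous (convL2 hW).continuous ?_
  funext φ
  exact Lp.ext ((hT φ).trans (convL2_toLp hW φ).symm)

/-- Regularity of the symbol `w = Ŵ`: `w` is differentiable a.e.; its a.e. defined partial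
derivatives `∂_k w` are also its weak derivatives; and for all `j, k` the map `ξ ↦ ξ_j ∂_k w(ξ)`
is bounded and continuous a.e., where, as this map is only defined up to a null set, this
means that it has a bounded representative which is continuous at almost every point. -/
structure RegularSymbol (w : Eu N → ℂ) : Prop where
  differentiable_ae : ∀ᵐ ξ : Eu N, DifferentiableAt ℝ w ξ
  weakDeriv : ∀ k : Fin N, IsWeakPartialDeriv k w (fun ξ => fderiv ℝ w ξ (e k))
  bounded_continuous_ae : ∀ j k : Fin N, ∃ h : Eu N → ℂ,
    (h =ᵐ[volume] fun ξ => (ξ j : ℂ) * fderiv ℝ w ξ (e k)) ∧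
    (∃ C : ℝ, ∀ ξ, ‖h ξ‖ ≤ C) ∧ ∀ᵐ ξ : Eu N, ContinuousAt h ξ

/-- A real-valued `f ∈ L²(ℝ^N)` as an element of the complex space `L²(ℝ^N; ℂ)`. -/
def complexL2 {f : Eu N → ℝ} (hf : MemLp f 2 volume) : L2 N :=
  MemLp.toLp (fun x => (f x : ℂ)) hf.ofReal

end Pohozaev

end

/-! Let `m` be the symbol of `W *` for `𝓕`, and write `x_j χ_n = a` with `a(x) = n b(x/n)`, `b(x) =
x_j χ(|x|)`. For `f` in `H¹`, integration by parts and the commutation of `W *` with `∂_j` give `2 ∫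
a ∂_j f (W * f) = -∫ ∂_j a f (W * f) - ∫ a (f (W * ∂_j f) - ∂_j f (W * f))`. Since `∂_j a = (∂_j
b)(x/n)` tends boundedly to `1`, the first term on the right yields the `1/4 ∫ (W * f) f` of the
limit.

The second term is a commutator of `W *` with `a`. At frequency `c`, the Fourier transform of the
bracket is `2πi ∫ ξ_j (m(ξ) - m(ξ - c)) 𝓕f(c - ξ) 𝓕f(ξ) dξ` (`integral_character_commutator`);
evenness of `W` enters here. Expanding `a` in characters puts `c = ζ/n`, and the factor `n` in `a`
turns the difference into a difference quotient, with limit `ξ_j ∂_ζ m(ξ)`. This is linear in `ζ`,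
so integrating it against `𝓕⁻ b` sees only the gradient of `b` at `0`, which is `e_j`
(`tendsto_integral_commIntegrand`). Reality of `f` makes `𝓕f(-ξ) 𝓕f(ξ) = |𝓕f(ξ)|²`.

The analytic core is `|ξ| |m(ξ) - m(ξ - c)| ≤ C |c|` (`exists_norm_mul_norm_symbol_sub_le`). It
bounds the commutator form on `L²` although a derivative of `f` is involved, so the identity passes
from `H¹` to `L² ∩ H¹_loc` (`commutator_identity`), and it dominates the limit in `n`. -/

noncomputable section

namespace Pohozaev

variable {N : ℕ}

/-! ### Weighted bilinear integrals on `L²` -/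

section BilinearL2

variable {α : Type*} [MeasurableSpace α] {μ : Measure α}

theorem integrable_mul_mul {κ : α → ℂ} {K : ℝ} (hκm : AEStronglyMeasurable κ μ)
    (hκ : ∀ᵐ x ∂μ, ‖κ x‖ ≤ K) (u v : Lp ℂ 2 μ) :
    Integrable (fun x => κ x * (u x * v x)) μ :=
  ((Lp.memLp u).integrable_mul (Lp.memLp v)).bdd_mul hκm hκ

/-- Cauchy–Schwarz, with the weight absorbed into `v`. The integrand is bilinear, hence the `star u`
in the sesquilinear inner product. -/
theorem norm_integral_mul_mul_le {κ : α → ℂ} {K : ℝ} (_ : 0 ≤ K)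
    (hκm : AEStronglyMeasurable κ μ)
    (hκ : ∀ᵐ x ∂μ, ‖κ x‖ ≤ K) (u v : Lp ℂ 2 μ) :
    ‖∫ x, κ x * (u x * v x) ∂μ‖ ≤ K * (‖u‖ * ‖v‖) := by
  have hle : ∀ᵐ x ∂μ, ‖κ x * v x‖ ≤ K * ‖v x‖ := by
    filter_upwards [hκ] with x hx
    rw [norm_mul]
    gcongr
  have hm : MemLp (fun x => κ x * v x) 2 μ :=
    (Lp.memLp v).of_le_mul (hκm.mul (Lp.aestronglyMeasurable v)) hle
  have h1 : ‖hm.toLp‖ ≤ K * ‖v‖ := by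
    refine Lp.norm_le_mul_norm_of_ae_le_mul ?_
    filter_upwards [hm.coeFn_toLp, hle] with x hx hx'
    rwa [hx]
  have h2 : ∫ x, κ x * (u x * v x) ∂μ = inner ℂ (star u) hm.toLp := by
    rw [L2.inner_def]
    refine integral_congr_ae ?_
    filter_upwards [hm.coeFn_toLp, Lp.coeFn_star u] with x hx hx'
    rw [hx, hx']
    simp
    ring
  rw [h2]
  calc _ ≤ ‖star u‖ * ‖hm.toLp‖ := norm_inner_le_norm _ _
    _ ≤ ‖u‖ * (K * ‖v‖) := by
      gcongr
      refine Lp.norm_le_norm_of_ae_le ?_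
      filter_upwards [Lp.coeFn_star u] with x hx
      rw [hx, Pi.star_apply, norm_star]
    _ = _ := by ring

/-- Replacing `u n`, `v n` by their limits costs `O(‖u n - u'‖ + ‖v n - v'‖)` because the weights
are uniformly bounded; dominated convergence handles the fixed pair `u'`, `v'`. Most later limits
are instances of this. -/
theorem tendsto_integral_mul_mul {κ : ℕ → α → ℂ} {κ' : α → ℂ} {K : ℝ}
    (hκm : ∀ n, AEStronglyMeasurable (κ n) μ) (hκ : ∀ n, ∀ᵐ x ∂μ, ‖κ n x‖ ≤ K)
    (hlim : ∀ᵐ x ∂μ, Tendsto (fun n => κ n x) atTop (𝓝 (κ' x)))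
    {u v : ℕ → Lp ℂ 2 μ} {u' v' : Lp ℂ 2 μ}
    (hu : Tendsto u atTop (𝓝 u')) (hv : Tendsto v atTop (𝓝 v')) :
    Tendsto (fun n => ∫ x, κ n x * (u n x * v n x) ∂μ) atTop
      (𝓝 (∫ x, κ' x * (u' x * v' x) ∂μ)) := by
  have hK0 : 0 ≤ max K 0 := le_max_right _ _
  have hκ0 : ∀ n, ∀ᵐ x ∂μ, ‖κ n x‖ ≤ max K 0 := fun n => by
    filter_upwards [hκ n] with x hx using hx.trans (le_max_left _ _)
  have h1 : Tendsto (fun n => ∫ x, κ n x * (u' x * v' x) ∂μ) atTop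
      (𝓝 (∫ x, κ' x * (u' x * v' x) ∂μ)) := by
    refine tendsto_integral_of_dominated_convergence (fun x => K * ‖u' x * v' x‖)
      (fun n => (integrable_mul_mul (hκm n) (hκ n) u' v').aestronglyMeasurable)
      (((Lp.memLp u').integrable_mul (Lp.memLp v')).norm.const_mul K) (fun n => ?_) ?_
    · filter_upwards [hκ n] with x hx
      rw [norm_mul]
      gcongr
    · filter_upwards [hlim] with x hx
      exact hx.mul_const _
  have h2 : Tendsto (fun n => ∫ x, κ n x * ((u n - u') x * v n x) ∂μ) atTop (𝓝 0) := by
    refine squeeze_zero_norm (fun n => norm_integral_mul_mul_le hK0 (hκm n) (hκ0 n) _ _) ?_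
    have := ((tendsto_iff_norm_sub_tendsto_zero.1 hu).mul hv.norm).const_mul (max K 0)
    simpa using this
  have h3 : Tendsto (fun n => ∫ x, κ n x * (u' x * (v n - v') x) ∂μ) atTop (𝓝 0) := by
    refine squeeze_zero_norm (fun n => norm_integral_mul_mul_le hK0 (hκm n) (hκ0 n) _ _) ?_
    have := ((tendsto_iff_norm_sub_tendsto_zero.1 hv).const_mul ‖u'‖).const_mul (max K 0)
    simpa using this
  have h4 := (h1.add h2).add h3
  simp only [add_zero] at h4
  refine h4.congr fun n => ?_
  have hi := fun w z : Lp ℂ 2 μ => integrable_mul_mul (hκm n) (hκ n) w z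
  rw [← integral_add (hi u' v') (hi (u n - u') (v n)),
    ← integral_add (f := fun x => κ n x * (u' x * v' x) + κ n x * ((u n - u') x * v n x))
      ((hi u' v').add (hi (u n - u') (v n))) (hi u' (v n - v'))]
  refine integral_congr_ae ?_
  filter_upwards [Lp.coeFn_sub (u n) u', Lp.coeFn_sub (v n) v'] with x h1 h2
  simp only [h1, h2, Pi.sub_apply]
  ring

end BilinearL2

/-! ### Fourier transform on `L²`: reflection, reality, products -/

/-- The function `ξ ↦ F (c - ξ)` in `L²`. -/
def reflectLp (c : Eu N) (F : L2 N) : L2 N :=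
  Lp.compMeasurePreserving (fun ξ => c - ξ) (Measure.measurePreserving_sub_left volume c) F

theorem coeFn_reflectLp (c : Eu N) (F : L2 N) :
    reflectLp c F =ᵐ[volume] fun ξ => F (c - ξ) :=
  Lp.coeFn_compMeasurePreserving F (Measure.measurePreserving_sub_left volume c)

/-- Strong continuity of translations in `L²`: the maps `ξ ↦ c - ξ` preserve measure and depend
continuously on `c` in the compact-open topology. -/
theorem tendsto_reflectLp {ι : Type*} {l : Filter ι} {c : ι → Eu N} {c' : Eu N}
    {F : ι → L2 N} {F' : L2 N} (hc : Tendsto c l (𝓝 c')) (hF : Tendsto F l (𝓝 F')) :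
    Tendsto (fun i => reflectLp (c i) (F i)) l (𝓝 (reflectLp c' F')) := by
  let g : Eu N → C(Eu N, Eu N) := fun c => ⟨fun ξ => c - ξ, by fun_prop⟩
  have hg : Continuous g := ContinuousMap.continuous_of_continuous_uncurry _ (by
    simp only [g, Function.uncurry_def, ContinuousMap.coe_mk]
    fun_prop)
  exact hF.compMeasurePreservingLp ((hg.tendsto c').comp hc)
    (fun i => Measure.measurePreserving_sub_left volume (c i))
    (Measure.measurePreserving_sub_left volume c')
    ENNReal.ofNat_ne_top

theorem locallyIntegrable_coeFn_L2 (u : L2 N) : LocallyIntegrable u volume :=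
  (Lp.memLp u).locallyIntegrable one_le_two

theorem ae_eq_of_integral_mul_schwartz {u v : Eu N → ℂ} (hu : LocallyIntegrable u volume)
    (hv : LocallyIntegrable v volume)
    (h : ∀ ψ : 𝓢(Eu N, ℂ), ∫ x, u x * ψ x = ∫ x, v x * ψ x) : u =ᵐ[volume] v := by
  refine ae_eq_of_integral_contDiff_smul_eq hu hv fun g hg hgc => ?_
  have hc : HasCompactSupport (fun x => (g x : ℂ)) := hgc.comp_left Complex.ofReal_zero
  have := h (hc.toSchwartzMap (Complex.ofRealCLM.contDiff.comp hg))
  simp only [Complex.real_smul, mul_comm (g _ : ℂ)]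
  exact this

theorem integral_fourier_mul (u : L2 N) (ψ : 𝓢(Eu N, ℂ)) :
    ∫ ξ, (𝓕 u : L2 N) ξ * ψ ξ = ∫ x, u x * (𝓕 ψ) x := by
  have h := congrArg (fun S : 𝓢'(Eu N, ℂ) => S ψ) (Lp.fourier_toTemperedDistribution_eq u)
  simp only [TemperedDistribution.fourier_apply, Lp.toTemperedDistribution_apply, smul_eq_mul] at h
  simp only [mul_comm ((𝓕 u : L2 N) _), mul_comm (u _)]
  exact h.symm

/-- The candidate `V` need only be locally integrable, so products such as `m ψ` or `ξ_j 𝓕f` qualify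
before they are known to lie in `L²`. -/
theorem fourier_ae_eq_of_schwartz {u : L2 N} {V : Eu N → ℂ} (hV : LocallyIntegrable V volume)
    (h : ∀ ψ : 𝓢(Eu N, ℂ), ∫ x, V x * ψ x = ∫ x, u x * (𝓕 ψ) x) :
    (𝓕 u : L2 N) =ᵐ[volume] V :=
  ae_eq_of_integral_mul_schwartz (locallyIntegrable_coeFn_L2 _) hV fun ψ => by
    rw [integral_fourier_mul, h]

/-- The function `ξ ↦ conj (ψ (-ξ))` is a Schwartz function. -/
theorem exists_schwartz_conj_neg (ψ : 𝓢(Eu N, ℂ)) :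
    ∃ ψ' : 𝓢(Eu N, ℂ), ∀ ξ, ψ' ξ = starRingEnd ℂ (ψ (-ξ)) := by
  refine ⟨SchwartzMap.postcompCLM (𝕜 := ℝ) (Complex.conjCLE : ℂ →L[ℝ] ℂ)
    (SchwartzMap.compCLMOfContinuousLinearEquiv ℂ (ContinuousLinearEquiv.neg ℝ) ψ),
    fun ξ => by simp⟩

/-- Obtained by duality, testing against `conj (ψ (-ξ))`. It is what finally produces `|𝓕f|²` from a
bilinear expression. -/
theorem fourier_conj_neg {u : L2 N} (hu : ∀ᵐ x, starRingEnd ℂ (u x) = u x) :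
    ∀ᵐ ξ, (𝓕 u : L2 N) (-ξ) = starRingEnd ℂ ((𝓕 u : L2 N) ξ) := by
  have hV : LocallyIntegrable (fun ξ => starRingEnd ℂ ((𝓕 u : L2 N) (-ξ))) volume := by
    have h := (Lp.memLp (star (reflectLp 0 (𝓕 u : L2 N)))).locallyIntegrable one_le_two
    refine h.congr ?_
    filter_upwards [Lp.coeFn_star (reflectLp 0 (𝓕 u : L2 N)), coeFn_reflectLp 0 (𝓕 u : L2 N)]
      with x h1 h2
    rw [h1, Pi.star_apply, h2]
    simp
  have key := fourier_ae_eq_of_schwartz (u := u) hV fun ψ => by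
    obtain ⟨ψ', hψ'⟩ := exists_schwartz_conj_neg ψ
    have hF : ∀ x, (𝓕 ψ') x = starRingEnd ℂ ((𝓕 ψ) x) := fun x => by
      simp only [SchwartzMap.fourier_coe, Real.fourier_eq']
      rw [← integral_conj, ← integral_neg_eq_self]
      congr 1 with y
      simp [hψ', ← Complex.exp_conj, Complex.conj_ofNat]
    have h := integral_fourier_mul u ψ'
    calc ∫ ξ, starRingEnd ℂ ((𝓕 u : L2 N) (-ξ)) * ψ ξ
        = starRingEnd ℂ (∫ ξ, (𝓕 u : L2 N) ξ * ψ' ξ) := by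
          rw [← integral_conj, ← integral_neg_eq_self]
          simp [hψ']
      _ = _ := by
          rw [h, ← integral_conj]
          refine integral_congr_ae ?_
          filter_upwards [hu] with x hx
          simp [hF, hx]
  filter_upwards [key] with x hx
  rw [hx]
  simp

/-- The function `ξ ↦ ψ (c - ξ)` is a Schwartz function. -/
theorem exists_schwartz_sub_left (ψ : 𝓢(Eu N, ℂ)) (c : Eu N) :
    ∃ ψ' : 𝓢(Eu N, ℂ), ∀ ξ, ψ' ξ = ψ (c - ξ) :=
  ⟨reflectTranslate ψ c, fun ξ => reflectTranslate_apply ψ c ξ⟩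

/-- The character `x ↦ exp (-2πi x·c)`. -/
def character (c x : Eu N) : ℂ := Complex.exp ((-2 * Real.pi * inner ℝ x c : ℝ) * Complex.I)

theorem norm_character (c x : Eu N) : ‖character c x‖ = 1 :=
  Complex.norm_exp_ofReal_mul_I _

theorem continuous_character : Continuous (fun p : Eu N × Eu N => character p.1 p.2) := by
  unfold character
  fun_prop

theorem fourier_apply_eq (ψ : 𝓢(Eu N, ℂ)) (c : Eu N) :
    (𝓕 ψ) c = ∫ x, character c x * ψ x := by
  rw [SchwartzMap.fourier_coe, Real.fourier_eq']
  rfl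

theorem continuous_integral_mul_mul {α : Type*} [MeasurableSpace α] {μ : Measure α}
    {κ : α → ℂ} {K : ℝ} (hκm : AEStronglyMeasurable κ μ) (hκ : ∀ᵐ x ∂μ, ‖κ x‖ ≤ K) :
    Continuous (fun p : Lp ℂ 2 μ × Lp ℂ 2 μ => ∫ x, κ x * (p.1 x * p.2 x) ∂μ) := by
  refine continuous_iff_seqContinuous.mpr fun p q hpq => ?_
  exact tendsto_integral_mul_mul (fun _ => hκm) (fun _ => hκ)
    (ae_of_all _ fun _ => tendsto_const_nhds)
    ((continuous_fst.tendsto q).comp hpq) ((continuous_snd.tendsto q).comp hpq)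

/-- The Fourier transform of a product of two functions of `L²` is the convolution of their
Fourier transforms. -/
theorem integral_character_mul (c : Eu N) (u v : L2 N) :
    ∫ x, character c x * (u x * v x) = ∫ ξ, (𝓕 u : L2 N) (c - ξ) * (𝓕 v : L2 N) ξ := by
  have hc : Continuous (character c : Eu N → ℂ) :=
    continuous_character.comp (Continuous.prodMk_right c)
  have hL := continuous_integral_mul_mul (μ := (volume : Measure (Eu N))) hc.aestronglyMeasurable
    (ae_of_all _ fun x => (norm_character c x).le)
  have hR := continuous_integral_mul_mul (μ := (volume : Measure (Eu N))) (κ := fun _ => 1) (K := 1)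
    aestronglyMeasurable_const (by simp)
  have hrefl : Continuous (fun F : L2 N => reflectLp c F) :=
    continuous_iff_continuousAt.2 fun F => tendsto_reflectLp tendsto_const_nhds tendsto_id
  have hF : Continuous (fun u : L2 N => (𝓕 u : L2 N)) :=
    (Lp.fourierTransformₗᵢ (Eu N) ℂ).continuous
  have hR' : Continuous (fun p : L2 N × L2 N =>
      ∫ ξ, (1 : ℂ) * (reflectLp c (𝓕 p.1 : L2 N) ξ * (𝓕 p.2 : L2 N) ξ)) := by
    have h1 : Continuous (fun p : L2 N × L2 N => (reflectLp c (𝓕 p.1 : L2 N), (𝓕 p.2 : L2 N))) :=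
      (hrefl.comp (hF.comp continuous_fst)).prodMk (hF.comp continuous_snd)
    have h2 := hR.comp h1
    simpa only [Function.comp_def] using h2
  have hd := SchwartzMap.denseRange_toLpCLM (E := Eu N) (F := ℂ) (μ := volume) (p := 2)
    ENNReal.ofNat_ne_top
  have key : ∀ u v : L2 N, ∫ x, character c x * (u x * v x) =
      ∫ ξ, (1 : ℂ) * (reflectLp c (𝓕 u : L2 N) ξ * (𝓕 v : L2 N) ξ) := by
    intro u v
    have hcl : IsClosed {p : L2 N × L2 N | ∫ x, character c x * (p.1 x * p.2 x) =
      ∫ ξ, (1 : ℂ) * (reflectLp c (𝓕 p.1 : L2 N) ξ * (𝓕 p.2 : L2 N) ξ)} := isClosed_eq hL hR'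
    refine isClosed_property2 hd (p := fun u v : L2 N => ∫ x, character c x * (u x * v x) =
      ∫ ξ, (1 : ℂ) * (reflectLp c (𝓕 u : L2 N) ξ * (𝓕 v : L2 N) ξ)) hcl (fun φ ψ => ?_) u v
    simp only [SchwartzMap.toLpCLM_apply, SchwartzMap.toLp_fourier_eq]
    -- By inversion `θ = 𝓕φ(c - ·)` has Fourier transform `character c · φ`, so for Schwartz
    -- functions the claim is `∫ 𝓕θ ψ = ∫ θ 𝓕ψ`. Both sides being jointly continuous on `L² × L²`,
    -- density does the rest.
    obtain ⟨θ, hθ⟩ := exists_schwartz_sub_left (𝓕 φ) c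
    have h1 : ∀ x, (𝓕 θ) x = character c x * φ x := fun x => by
      have hinv : (𝓕⁻ (𝓕 φ)) x = φ x := by rw [FourierTransform.fourierInv_fourier_eq]
      rw [SchwartzMap.fourierInv_coe, Real.fourierInv_eq'] at hinv
      rw [← hinv, fourier_apply_eq, ← integral_const_mul, ← integral_sub_left_eq_self _ volume c]
      congr 1 with y
      rw [hθ, sub_sub_cancel, smul_eq_mul, ← mul_assoc, character, character, ← Complex.exp_add]
      congr 2
      rw [← add_mul, ← Complex.ofReal_add, inner_sub_left, real_inner_comm c x]
      congr 2
      ring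
    have h2 := SchwartzMap.integral_fourier_mul_eq θ ψ
    calc _ = ∫ x, character c x * (φ x * ψ x) := by
          refine integral_congr_ae ?_
          filter_upwards [φ.coeFn_toLp 2 volume, ψ.coeFn_toLp 2 volume] with x h3 h4
          rw [h3, h4]
      _ = ∫ x, θ x * (𝓕 ψ) x := by
          rw [← h2]
          simp only [h1, mul_assoc]
      _ = _ := by
          refine integral_congr_ae ?_
          filter_upwards [coeFn_reflectLp c ((𝓕 φ).toLp 2),
            (Measure.measurePreserving_sub_left volume c).quasiMeasurePreserving.ae
              ((𝓕 φ).coeFn_toLp 2 volume),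
            (𝓕 ψ).coeFn_toLp 2 volume] with x h3 h4 h5
          rw [h3, h4, h5, hθ, one_mul]
  rw [key]
  refine integral_congr_ae ?_
  filter_upwards [coeFn_reflectLp c (𝓕 u : L2 N)] with x hx
  rw [hx, one_mul]

theorem integral_mul_eq_fourier (u v : L2 N) :
    ∫ x, u x * v x = ∫ ξ, (𝓕 u : L2 N) (-ξ) * (𝓕 v : L2 N) ξ := by
  simpa [character] using integral_character_mul 0 u v

/-! ### Bounded multiplication operators on `L²` -/

/-- As `m` is not assumed bounded, `h ↦ m h` has no evident `L²` continuity. Along a subsequence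
both the approximations and their images converge a.e., and multiplication by the number `m ξ`
respects pointwise limits. -/
theorem ae_eq_mul_of_schwartz {T : L2 N →L[ℂ] L2 N} {m : Eu N → ℂ}
    (hT : ∀ ψ : 𝓢(Eu N, ℂ), T (ψ.toLp 2) =ᵐ[volume] fun ξ => m ξ * ψ ξ) (h : L2 N) :
    T h =ᵐ[volume] fun ξ => m ξ * h ξ := by
  have hd := SchwartzMap.denseRange_toLpCLM (E := Eu N) (F := ℂ) (μ := volume) (p := 2)
    ENNReal.ofNat_ne_top
  obtain ⟨p, hp, hlim⟩ := mem_closure_iff_seq_limit.1 (hd h)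
  choose ψ hψ using hp
  obtain ⟨s, hs, hs'⟩ := (tendstoInMeasure_of_tendsto_Lp hlim).exists_seq_tendsto_ae
  have hlim' : Tendsto (fun k => T (p (s k))) atTop (𝓝 (T h)) :=
    (T.continuous.tendsto h).comp (hlim.comp hs.tendsto_atTop)
  obtain ⟨r, hr, hr'⟩ := (tendstoInMeasure_of_tendsto_Lp hlim').exists_seq_tendsto_ae
  have hall : ∀ᵐ ξ : Eu N, ∀ k, T (p k) ξ = m ξ * p k ξ := ae_all_iff.2 fun k => by
    rw [← hψ k]
    filter_upwards [hT (ψ k), (ψ k).coeFn_toLp 2 volume] with ξ h1 h2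
    rw [SchwartzMap.toLpCLM_apply, h1, h2]
  filter_upwards [hs', hr', hall] with ξ h1 h2 h3
  refine tendsto_nhds_unique h2 ?_
  simp only [h3]
  exact (h1.comp hr.tendsto_atTop).const_mul _

/-- Test `T` on the indicator `h` of `{‖m‖ > ‖T‖ + 1}` inside a ball: `(‖T‖ + 1) ‖h‖ ≤ ‖T‖ ‖h‖`
forces `h = 0`. The ball keeps the measure finite and the `+ 1` makes the gap strict. -/
theorem ae_norm_le_of_ae_eq_mul {T : L2 N →L[ℂ] L2 N} {m : Eu N → ℂ}
    (hm : AEStronglyMeasurable m volume)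
    (hT : ∀ h : L2 N, T h =ᵐ[volume] fun ξ => m ξ * h ξ) :
    ∀ᵐ ξ : Eu N, ‖m ξ‖ ≤ ‖T‖ + 1 := by
  have key : ∀ k : ℕ, ∀ᵐ ξ : Eu N, ξ ∈ Metric.ball (0 : Eu N) k → ‖m ξ‖ ≤ ‖T‖ + 1 := by
    intro k
    let A : Set (Eu N) := {ξ | ‖T‖ + 1 < ‖hm.mk m ξ‖} ∩ Metric.ball 0 k
    have hA : MeasurableSet A :=
      (measurableSet_lt measurable_const hm.stronglyMeasurable_mk.norm.measurable).inter
        measurableSet_ball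
    have hA' : volume A ≠ ⊤ :=
      ((measure_mono Set.inter_subset_right).trans_lt measure_ball_lt_top).ne
    let h : L2 N := indicatorConstLp 2 hA hA' 1
    have h1 : ‖(((‖T‖ + 1 : ℝ) : ℂ)) • h‖ ≤ ‖T h‖ := by
      refine Lp.norm_le_norm_of_ae_le ?_
      filter_upwards [hT h, Lp.coeFn_smul (((‖T‖ + 1 : ℝ) : ℂ)) h,
        indicatorConstLp_coeFn (p := 2) (hs := hA) (hμs := hA') (c := (1 : ℂ)), hm.ae_eq_mk]
        with ξ e1 e2 e3 e4
      rw [e1, e2, Pi.smul_apply, smul_eq_mul, norm_mul, norm_mul]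
      by_cases hξ : ξ ∈ A
      · gcongr
        rw [e4, Complex.norm_real, Real.norm_of_nonneg (by positivity)]
        exact hξ.1.le
      · have : h ξ = 0 := by rw [e3, Set.indicator_of_notMem hξ]
        simp [this]
    have h2 : (‖T‖ + 1) * ‖h‖ ≤ ‖T‖ * ‖h‖ := by
      refine le_trans (le_of_eq ?_) (h1.trans (T.le_opNorm h))
      rw [norm_smul, Complex.norm_real, Real.norm_of_nonneg (by positivity)]
    have h3 : ‖h‖ = 0 := le_antisymm (by linarith) (norm_nonneg _)
    have h4 : h =ᵐ[volume] 0 := by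
      rw [norm_eq_zero.1 h3]
      exact Lp.coeFn_zero _ _ _
    filter_upwards [h4, indicatorConstLp_coeFn (p := 2) (hs := hA) (hμs := hA') (c := (1 : ℂ)),
      hm.ae_eq_mk] with ξ e1 e2 e3 hξ
    by_contra! hlt
    have hξA : ξ ∈ A := ⟨by rwa [e3] at hlt, hξ⟩
    change h ξ = _ at e2
    rw [e1, Set.indicator_of_mem hξA] at e2
    simp at e2
  filter_upwards [ae_all_iff.2 key] with ξ hξ
  obtain ⟨k, hk⟩ := exists_nat_gt ‖ξ‖
  exact hξ k (by simpa using hk)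

/-! ### Convolution with `W` as a Fourier multiplier -/

theorem aestronglyMeasurable_comp_smul {w : Eu N → ℂ} (hw : AEStronglyMeasurable w volume)
    {c : ℝ} (hc : c ≠ 0) : AEStronglyMeasurable (fun ξ => w (c • ξ)) volume :=
  hw.comp_quasiMeasurePreserving (Measure.quasiMeasurePreserving_smul volume hc)

/-- The symbol of `f ↦ W * f` in Mathlib's normalisation of the Fourier transform. -/
def symbol (w : Eu N → ℂ) (ξ : Eu N) : ℂ := w ((2 * Real.pi) • ξ)

theorem exists_schwartz_smul (ψ : 𝓢(Eu N, ℂ)) :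
    ∃ ψ' : 𝓢(Eu N, ℂ), ∀ ξ, ψ' ξ = ψ ((2 * Real.pi)⁻¹ • ξ) :=
  ⟨SchwartzMap.compCLMOfContinuousLinearEquiv ℂ (dilation N) ψ, fun _ => rfl⟩

variable {W : 𝓢'(Eu N, ℂ)} {w : Eu N → ℂ}

theorem IsFourierTransform.aestronglyMeasurable_symbol (hw : IsFourierTransform W w) :
    AEStronglyMeasurable (symbol w) volume :=
  aestronglyMeasurable_comp_smul hw.1.aestronglyMeasurable (by positivity)

theorem IsFourierTransform.integrable_symbol_mul (hw : IsFourierTransform W w)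
    (ψ : 𝓢(Eu N, ℂ)) : Integrable (fun ξ => symbol w ξ * ψ ξ) := by
  obtain ⟨ψ', hψ'⟩ := exists_schwartz_smul ψ
  have h := (integrable_comp_smul_iff volume (fun ξ => w ξ * ψ' ξ)
    (R := 2 * Real.pi) (by positivity)).2 (hw.2 ψ').1
  refine h.congr (ae_of_all _ fun ξ => ?_)
  simp only [hψ', symbol]
  rw [inv_smul_smul₀ (by positivity)]

theorem IsFourierTransform.convSchwartz_eq (hw : IsFourierTransform W w) (φ : 𝓢(Eu N, ℂ))
    (x : Eu N) :
    convSchwartz W φ x = ∫ ξ, symbol w ξ * (𝓕 φ) ξ * character (-x) ξ := by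
  have h2pi : (2 * Real.pi : ℝ) ≠ 0 := by positivity
  -- `R(y) = φ(x - 2πy)` undoes the dilation in `fourierSchwartz`, so that `φ(x - ·)` is
  -- `fourierSchwartz (𝓕⁻ R)`. The Jacobian `(2π)^{-N}` then arises once from `𝓕⁻ R` and once from
  -- rescaling the final integral, and cancels.
  let R := SchwartzMap.compCLMOfContinuousLinearEquiv ℂ (dilation N).symm (reflectTranslate φ x)
  have hdil : ∀ y, (dilation N).symm y = (2 * Real.pi) • y := fun y => by
    rw [ContinuousLinearEquiv.symm_apply_eq]
    change y = (2 * Real.pi)⁻¹ • (2 * Real.pi) • y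
    rw [inv_smul_smul₀ h2pi]
  have hR : fourierSchwartz (𝓕⁻ R) = reflectTranslate φ x := by
    rw [fourierSchwartz, FourierTransform.fourier_fourierInv_eq]
    ext y
    simp [R]
  have hψ : ∀ η, (𝓕⁻ R) ((2 * Real.pi) • η) =
      (|((2 * Real.pi) ^ Module.finrank ℝ (Eu N))⁻¹| : ℝ) • ((𝓕 φ) η * character (-x) η) := by
    intro η
    rw [SchwartzMap.fourierInv_coe, Real.fourierInv_eq']
    have h1 : (fun y : Eu N => Complex.exp (↑(2 * Real.pi * inner ℝ y ((2 * Real.pi) • η)) *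
        Complex.I) • R y) = fun y => (fun z : Eu N => character (-η) z * φ (x - z))
          ((2 * Real.pi) • y) := by
      funext y
      simp only [R, SchwartzMap.compCLMOfContinuousLinearEquiv_apply, Function.comp_apply, hdil,
        reflectTranslate_apply, smul_eq_mul, character]
      congr 3
      rw [inner_smul_right, inner_neg_right, inner_smul_left]
      simp
    rw [h1, Measure.integral_comp_smul volume (fun z : Eu N => character (-η) z * φ (x - z)),
      fourier_apply_eq]
    congr 1
    rw [← integral_mul_const, ← integral_sub_left_eq_self _ volume x]
    congr 1 with z
    rw [sub_sub_cancel, mul_right_comm, character, character, character, ← Complex.exp_add]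
    congr 2
    rw [← add_mul, ← Complex.ofReal_add]
    simp only [inner_sub_left, inner_neg_right, real_inner_comm x η]
    congr 2
    ring
  rw [convSchwartz, ← hR, (hw.2 _).2]
  have h3 := Measure.integral_comp_smul volume (fun ξ => w ξ * (𝓕⁻ R) ξ) (2 * Real.pi)
  have hpos : (0 : ℝ) < |((2 * Real.pi) ^ Module.finrank ℝ (Eu N))⁻¹| := by positivity
  have h4 : (∫ η, w ((2 * Real.pi) • η) * (𝓕⁻ R) ((2 * Real.pi) • η)) =
      (|((2 * Real.pi) ^ Module.finrank ℝ (Eu N))⁻¹| : ℝ) •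
        ∫ ξ, symbol w ξ * (𝓕 φ) ξ * character (-x) ξ := by
    rw [← integral_smul]
    congr 1 with η
    rw [hψ, symbol, mul_smul_comm, mul_assoc]
  exact smul_right_injective ℂ hpos.ne' (h3.symm.trans h4)

theorem character_neg_comm (x ξ : Eu N) : character (-x) ξ = character (-ξ) x := by
  simp only [character, inner_neg_right, real_inner_comm x ξ]

/-- Stated for the conjugate of `W *` by `𝓕`, so that the lemmas on multiplication operators apply.
Fubini is available because `m ψ` is integrable. -/
theorem fourier_convL2_fourierInv_schwartz (hW : MemM22 W) (hw : IsFourierTransform W w)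
    (ψ : 𝓢(Eu N, ℂ)) :
    (𝓕 (convL2 hW (𝓕⁻ (ψ.toLp 2) : L2 N)) : L2 N) =ᵐ[volume] fun ξ => symbol w ξ * ψ ξ := by
  rw [SchwartzMap.toLp_fourierInv_eq]
  have hV := hw.integrable_symbol_mul ψ
  refine fourier_ae_eq_of_schwartz hV.locallyIntegrable fun θ => ?_
  have hu : ∀ᵐ x, convL2 hW ((𝓕⁻ ψ).toLp 2) x =
      ∫ ξ, symbol w ξ * ψ ξ * character (-x) ξ := by
    filter_upwards [convL2_toLp hW (𝓕⁻ ψ)] with x hx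
    rw [hx, hw.convSchwartz_eq, FourierTransform.fourier_fourierInv_eq]
  have hθ : ∀ ξ, θ ξ = ∫ x, character (-x) ξ * (𝓕 θ) x := fun ξ => by
    have hinv : (𝓕⁻ (𝓕 θ)) ξ = θ ξ := by rw [FourierTransform.fourierInv_fourier_eq]
    rw [← hinv, SchwartzMap.fourierInv_coe, Real.fourierInv_eq']
    congr 1 with x
    rw [character_neg_comm, character, smul_eq_mul, inner_neg_right]
    congr 3
    ring_nf
  have hint : Integrable (Function.uncurry fun ξ x : Eu N =>
      symbol w ξ * ψ ξ * (𝓕 θ) x * character (-x) ξ) (volume.prod volume) := by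
    refine (hV.mul_prod (𝓕 θ).integrable).mul_bdd (c := 1) ?_ ?_
    · exact (continuous_character.comp (continuous_snd.neg.prodMk continuous_fst)).aestronglyMeasurable
    · exact ae_of_all _ fun p => (norm_character _ _).le
  calc ∫ ξ, symbol w ξ * ψ ξ * θ ξ
      = ∫ ξ, ∫ x, symbol w ξ * ψ ξ * (𝓕 θ) x * character (-x) ξ := by
        congr 1 with ξ
        rw [hθ, ← integral_const_mul]
        congr 1 with x
        ring
    _ = ∫ x, ∫ ξ, symbol w ξ * ψ ξ * (𝓕 θ) x * character (-x) ξ := integral_integral_swap hint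
    _ = _ := by
        refine integral_congr_ae ?_
        filter_upwards [hu] with x hx
        rw [hx, ← integral_mul_const]
        congr 1 with ξ
        ring

theorem exists_multiplier (hW : MemM22 W) (hw : IsFourierTransform W w) :
    ∃ T : L2 N →L[ℂ] L2 N, (∀ f : L2 N, T (𝓕 f : L2 N) = 𝓕 (convL2 hW f)) ∧
      ∀ h : L2 N, T h =ᵐ[volume] fun ξ => symbol w ξ * h ξ := by
  let Φ : L2 N ≃L[ℂ] L2 N := (Lp.fourierTransformₗᵢ (Eu N) ℂ).toContinuousLinearEquiv
  refine ⟨(Φ : L2 N →L[ℂ] L2 N) ∘L convL2 hW ∘L (Φ.symm : L2 N →L[ℂ] L2 N), fun f => ?_, ?_⟩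
  · change Φ (convL2 hW (Φ.symm (Φ f))) = Φ (convL2 hW f)
    rw [Φ.symm_apply_apply]
  · exact ae_eq_mul_of_schwartz fun ψ => fourier_convL2_fourierInv_schwartz hW hw ψ

/-- The operator `f ↦ W * f` is the Fourier multiplier with symbol `Ŵ`. -/
theorem fourier_convL2 (hW : MemM22 W) (hw : IsFourierTransform W w) (f : L2 N) :
    (𝓕 (convL2 hW f) : L2 N) =ᵐ[volume] fun ξ => symbol w ξ * (𝓕 f : L2 N) ξ := by
  obtain ⟨T, hT, hT'⟩ := exists_multiplier hW hw
  rw [← hT]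
  exact hT' _

theorem exists_ae_norm_symbol_le (hW : MemM22 W) (hw : IsFourierTransform W w) :
    ∃ C : ℝ, ∀ᵐ ξ : Eu N, ‖symbol w ξ‖ ≤ C := by
  obtain ⟨T, -, hT'⟩ := exists_multiplier hW hw
  exact ⟨_, ae_norm_le_of_ae_eq_mul hw.aestronglyMeasurable_symbol hT'⟩

theorem ae_symbol_neg (heven : IsEven W) (hw : IsFourierTransform W w) :
    ∀ᵐ ξ : Eu N, symbol w (-ξ) = symbol w ξ := by
  have hneg : LocallyIntegrable (fun ξ => w (-ξ)) volume := by
    intro x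
    obtain ⟨U, hU, hU'⟩ := hw.1 (-x)
    refine ⟨Neg.neg ⁻¹' U, continuous_neg.continuousAt hU, ?_⟩
    exact ((Measure.measurePreserving_neg volume).integrableOn_comp_preimage
      (Homeomorph.neg (Eu N)).measurableEmbedding).2 hU'
  have h : (fun ξ => w (-ξ)) =ᵐ[volume] w := by
    refine ae_eq_of_integral_mul_schwartz hneg hw.1 fun ψ => ?_
    obtain ⟨ψ', hψ'⟩ := exists_schwartz_sub_left ψ 0
    have h1 := heven (fourierSchwartz ψ) (fourierSchwartz ψ') fun x => by
      rw [fourierSchwartz_apply, fourierSchwartz_apply, ← integral_neg_eq_self]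
      simp [hψ']
    rw [(hw.2 ψ).2, (hw.2 ψ').2] at h1
    rw [← h1, ← integral_neg_eq_self]
    simp [hψ']
  have h2 := (Measure.quasiMeasurePreserving_smul (volume : Measure (Eu N))
    (r := 2 * Real.pi) (by positivity)).ae h
  filter_upwards [h2] with ξ hξ
  simpa [symbol] using hξ

/-! ### From a weak gradient bound to a finite-difference bound -/

section Mollification

open scoped Convolution
open ContinuousLinearMap (lsmul)

theorem fderiv_apply_eq_sum {F : Type*} [NormedAddCommGroup F] [NormedSpace ℝ F] (u : Eu N → F)
    (ξ η : Eu N) : fderiv ℝ u ξ η = ∑ k, η k • fderiv ℝ u ξ (e k) := by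
  conv_lhs => rw [← (EuclideanSpace.basisFun (Fin N) ℝ).sum_repr η]
  simp [e]

/-- Sums the bounds on `ξ_j ∂_k w` over all `j, k`, using `|ξ| ≤ ∑ |ξ_j|`. One null set serves every
direction `η`. -/
theorem norm_mul_norm_fderiv_le {w : Eu N → ℂ} (hreg : RegularSymbol w) :
    ∃ C : ℝ, 0 ≤ C ∧ ∀ᵐ ξ : Eu N, ∀ η : Eu N, ‖ξ‖ * ‖fderiv ℝ w ξ η‖ ≤ C * ‖η‖ := by
  have hb : ∀ j k : Fin N, ∃ C : ℝ, ∀ᵐ ξ : Eu N, ‖(ξ j : ℂ) * fderiv ℝ w ξ (e k)‖ ≤ C := by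
    intro j k
    obtain ⟨h, hh, ⟨C, hC⟩, -⟩ := hreg.bounded_continuous_ae j k
    exact ⟨C, by filter_upwards [hh] with ξ hξ using hξ ▸ hC ξ⟩
  choose C hC using hb
  refine ⟨∑ j, ∑ k, |C j k|, by positivity, ?_⟩
  filter_upwards [ae_all_iff.2 fun j => ae_all_iff.2 fun k => hC j k] with ξ hξ η
  have h1 : ‖ξ‖ ≤ ∑ j, |ξ j| := by
    conv_lhs => rw [← (EuclideanSpace.basisFun (Fin N) ℝ).sum_repr ξ]
    refine (norm_sum_le _ _).trans (Finset.sum_le_sum fun j _ => ?_)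
    simp [norm_smul]
  have h2 : fderiv ℝ w ξ η = ∑ k, η k • fderiv ℝ w ξ (e k) := fderiv_apply_eq_sum w ξ η
  have h3 : ‖fderiv ℝ w ξ η‖ ≤ ∑ k, ‖η‖ * ‖fderiv ℝ w ξ (e k)‖ := by
    rw [h2]
    refine (norm_sum_le _ _).trans (Finset.sum_le_sum fun k _ => ?_)
    rw [norm_smul]
    gcongr
    exact PiLp.norm_apply_le η k
  calc ‖ξ‖ * ‖fderiv ℝ w ξ η‖ ≤ (∑ j, |ξ j|) * ∑ k, ‖η‖ * ‖fderiv ℝ w ξ (e k)‖ := by gcongr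
    _ = ∑ j, ∑ k, ‖(ξ j : ℂ) * fderiv ℝ w ξ (e k)‖ * ‖η‖ := by
        rw [Finset.sum_mul_sum]
        refine Finset.sum_congr rfl fun j _ => Finset.sum_congr rfl fun k _ => ?_
        rw [norm_mul, Complex.norm_real, Real.norm_eq_abs]
        ring
    _ ≤ ∑ j, ∑ k, |C j k| * ‖η‖ := by
        gcongr with j _ k _
        exact (hξ j k).trans (le_abs_self _)
    _ = _ := by simp_rw [← Finset.sum_mul]

theorem integral_fderiv_smul {w : Eu N → ℂ}
    (hweak : ∀ k : Fin N, IsWeakPartialDeriv k w (fun ξ => fderiv ℝ w ξ (e k)))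
    (φ : Eu N → ℝ) (hφ : ContDiff ℝ ∞ φ) (hφc : HasCompactSupport φ) (η : Eu N) :
    ∫ x, (fderiv ℝ φ x η) • w x = - ∫ x, φ x • fderiv ℝ w x η := by
  have h1 : ∀ k, Integrable (fun x => η k • ((fderiv ℝ φ x (e k)) • w x)) := fun k =>
    ((hweak k).locallyIntegrable.integrable_smul_left_of_hasCompactSupport
      ((hφ.continuous_fderiv (by simp)).clm_apply continuous_const) (hφc.fderiv_apply ℝ (e k))).smul (η k)
  have h2 : ∀ k, Integrable (fun x => η k • (φ x • fderiv ℝ w x (e k))) := fun k =>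
    ((hweak k).locallyIntegrable_deriv.integrable_smul_left_of_hasCompactSupport
      hφ.continuous hφc).smul (η k)
  have e1 : ∀ x, (fderiv ℝ φ x η) • w x = ∑ k, η k • ((fderiv ℝ φ x (e k)) • w x) := fun x => by
    rw [fderiv_apply_eq_sum, Finset.sum_smul]
    simp [mul_assoc]
  have e2 : ∀ x, φ x • fderiv ℝ w x η = ∑ k, η k • (φ x • fderiv ℝ w x (e k)) := fun x => by
    rw [fderiv_apply_eq_sum, Finset.smul_sum]
    exact Finset.sum_congr rfl fun k _ => smul_comm _ _ _
  simp_rw [e1, e2]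
  rw [integral_finsetSum _ fun k _ => h1 k, integral_finsetSum _ fun k _ => h2 k,
    ← Finset.sum_neg_distrib]
  refine Finset.sum_congr rfl fun k _ => ?_
  rw [integral_smul, integral_smul, (hweak k).integral_eq φ hφ hφc, smul_neg]

/-- A bound on the weak derivative on a ball bounds the derivative of the mollification at its
centre. -/
theorem norm_fderiv_convolution_le {w : Eu N → ℂ}
    (hweak : ∀ k : Fin N, IsWeakPartialDeriv k w (fun ξ => fderiv ℝ w ξ (e k)))
    (φ : ContDiffBump (0 : Eu N)) {x η : Eu N} {K : ℝ}
    (hK : ∀ᵐ y : Eu N, y ∈ Metric.ball x φ.rOut → ‖fderiv ℝ w y η‖ ≤ K) :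
    ‖fderiv ℝ (φ.normed volume ⋆[lsmul ℝ ℝ, volume] w) x η‖ ≤ K := by
  set ρ : Eu N → ℝ := φ.normed volume
  have hρ : ContDiff ℝ ∞ ρ := φ.contDiff_normed
  have hρc : HasCompactSupport ρ := φ.hasCompactSupport_normed
  -- In dimension `0` no index is available to supply local integrability of `w`, but then `η = 0`.
  obtain _ | k₀ := isEmpty_or_nonempty (Fin N)
  · have : η = 0 := Subsingleton.elim _ _
    subst this
    have hx : x ∈ Metric.ball x φ.rOut := Metric.mem_ball_self φ.rOut_pos
    have h0 : 0 ≤ K := by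
      obtain ⟨y, hy⟩ := hK.exists
      have := hy (by rwa [Subsingleton.elim y x])
      exact (norm_nonneg _).trans this
    simpa using h0
  have hwl : LocallyIntegrable w volume := (hweak k₀.some).locallyIntegrable
  have hweak' := integral_fderiv_smul hweak
  -- With `ψ` as test function the derivative moves from the mollifier to `w`; the result is an
  -- average of `∂_η w` over the ball of radius `φ.rOut` at `x`.
  let ψ : Eu N → ℝ := fun t => ρ (x - t)
  have hψ : ContDiff ℝ ∞ ψ := hρ.comp (contDiff_const.sub contDiff_id)
  have hψc : HasCompactSupport ψ := hρc.comp_homeomorph (Homeomorph.subLeft x)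
  have hψd : ∀ t, fderiv ℝ ψ t η = -fderiv ℝ ρ (x - t) η := fun t => by
    have h1 := ((hρ.differentiable (by simp)).differentiableAt (x := x - t)).hasFDerivAt.comp t
      ((hasFDerivAt_id t).const_sub x)
    have h2 : fderiv ℝ ψ t = _ := h1.fderiv
    rw [h2]
    simp
  have h1 : fderiv ℝ (ρ ⋆[lsmul ℝ ℝ, volume] w) x η = ∫ t, ψ t • fderiv ℝ w t η := by
    rw [← convolution_flip, (hρc.hasFDerivAt_convolution_right _ hwl (hρ.of_le (by simp)) x).fderiv,
      convolution_precompR_apply _ hwl (hρc.fderiv ℝ) (hρ.continuous_fderiv (by simp)),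
      convolution_def]
    have := hweak' ψ hψ hψc η
    rw [← neg_eq_iff_eq_neg] at this
    rw [← this, ← integral_neg]
    congr 1 with t
    rw [hψd]
    simp
  have hψi : Integrable ψ volume := hψ.continuous.integrable_of_hasCompactSupport hψc
  rw [h1]
  calc ‖∫ t, ψ t • fderiv ℝ w t η‖ ≤ ∫ t, ψ t * K := by
        refine norm_integral_le_of_norm_le (hψi.mul_const K) ?_
        filter_upwards [hK] with t ht
        have hψ0 : 0 ≤ ψ t := φ.nonneg_normed _
        rw [norm_smul, Real.norm_of_nonneg hψ0]
        by_cases h : ψ t = 0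
        · simp [h]
        · refine mul_le_mul_of_nonneg_left (ht ?_) hψ0
          have : x - t ∈ Function.support ρ := h
          rw [φ.support_normed_eq] at this
          rw [mem_ball_zero_iff] at this
          rwa [Metric.mem_ball, dist_comm, dist_eq_norm]
    _ = K := by
        rw [integral_mul_const]
        have : ∫ t, ψ t = 1 := by
          rw [← φ.integral_normed (μ := volume)]
          exact integral_sub_left_eq_self ρ volume x
        rw [this, one_mul]

/-- A derivative existing only a.e. does not control increments, so the mean value inequality is
applied to mollifications, whose gradients inherit the weak bound. On the segment from `ξ` to `ξ -
η` one stays at distance at least `|ξ|/2` from `0`; a mollification radius below `|ξ|/4` leaves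
`|ξ|/4`, whence the factor `4`. -/
theorem norm_sub_le_of_weakDeriv {w : Eu N → ℂ} (hreg : RegularSymbol w) :
    ∃ C : ℝ, 0 ≤ C ∧ ∀ η : Eu N, ∀ᵐ ξ : Eu N, 2 * ‖η‖ < ‖ξ‖ →
      ‖ξ‖ * ‖w ξ - w (ξ - η)‖ ≤ C * ‖η‖ := by
  obtain ⟨C, hC0, hC⟩ := norm_mul_norm_fderiv_le hreg
  refine ⟨4 * C, by positivity, fun η => ?_⟩
  obtain _ | k₀ := isEmpty_or_nonempty (Fin N)
  · exact ae_of_all _ fun ξ _ => by simp [Subsingleton.elim η 0]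
  have hwl : LocallyIntegrable w volume := (hreg.weakDeriv k₀.some).locallyIntegrable
  -- The fixed ratio `2` of outer to inner radius is what a.e. convergence of the mollifications
  -- requires.
  let φ : ℕ → ContDiffBump (0 : Eu N) := fun n =>
    ⟨1 / (n + 1 : ℝ), 2 * (1 / (n + 1 : ℝ)), by positivity, by
      have : (0 : ℝ) < 1 / (n + 1 : ℝ) := by positivity
      linarith⟩
  have hφ0 : Tendsto (fun n => (φ n).rOut) atTop (𝓝 0) := by
    have := (tendsto_one_div_add_atTop_nhds_zero_nat (𝕜 := ℝ)).const_mul 2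
    rwa [mul_zero] at this
  let u : ℕ → Eu N → ℂ := fun n => (φ n).normed volume ⋆[lsmul ℝ ℝ, volume] w
  have hud : ∀ n, Differentiable ℝ (u n) := fun n =>
    ((φ n).hasCompactSupport_normed.contDiff_convolution_left (n := 1) (lsmul ℝ ℝ)
      (φ n).contDiff_normed hwl).differentiable one_ne_zero
  have hlim : ∀ᵐ ξ : Eu N, Tendsto (fun n => u n ξ) atTop (𝓝 (w ξ)) :=
    ContDiffBump.ae_convolution_tendsto_right_of_locallyIntegrable (K := 2) hφ0
      (Eventually.of_forall fun n => le_rfl) hwl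
  have hlim' := (measurePreserving_sub_right volume η).quasiMeasurePreserving.ae hlim
  filter_upwards [hlim, hlim'] with ξ h1 h2 hη
  have hξ : 0 < ‖ξ‖ := by linarith [norm_nonneg η]
  have hbound : ∀ᶠ n in atTop, ‖u n ξ - u n (ξ - η)‖ ≤ 4 * C * ‖η‖ / ‖ξ‖ := by
    filter_upwards [hφ0.eventually (gt_mem_nhds (show (0 : ℝ) < ‖ξ‖ / 4 by positivity))] with n hn
    have hderiv : ∀ y, ‖ξ - y‖ ≤ ‖η‖ → ‖fderiv ℝ (u n) y η‖ ≤ 4 * C * ‖η‖ / ‖ξ‖ := by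
      intro y hy'
      refine norm_fderiv_convolution_le hreg.weakDeriv (φ n) ?_
      filter_upwards [hC] with z hz hzy
      have hz' : ‖ξ‖ / 4 ≤ ‖z‖ := by
        have e1 : ‖ξ‖ ≤ ‖z‖ + ‖ξ - y‖ + ‖z - y‖ := by
          have : ξ = z + (ξ - y) - (z - y) := by abel
          conv_lhs => rw [this]
          exact (norm_sub_le _ _).trans (by gcongr; exact norm_add_le _ _)
        have e2 : ‖z - y‖ < (φ n).rOut := by rwa [← dist_eq_norm]
        linarith
      rw [le_div_iff₀ hξ]
      have := hz η
      nlinarith [norm_nonneg (fderiv ℝ w z η)]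
    have hd : ∀ t : ℝ, HasDerivAt (fun t : ℝ => u n (ξ - t • η))
        (-fderiv ℝ (u n) (ξ - t • η) η) t := fun t => by
      have hl : HasDerivAt (fun t : ℝ => ξ - t • η) (-η) t := by
        simpa using ((hasDerivAt_id t).smul_const η).const_sub ξ
      have := (hud n (ξ - t • η)).hasFDerivAt.comp_hasDerivAt t hl
      rwa [map_neg] at this
    have := norm_image_sub_le_of_norm_deriv_le_segment_01' (C := 4 * C * ‖η‖ / ‖ξ‖)
      (fun t _ => (hd t).hasDerivWithinAt) fun t ht => by
        rw [norm_neg]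
        refine hderiv _ ?_
        rw [sub_sub_cancel, norm_smul, Real.norm_of_nonneg ht.1]
        exact mul_le_of_le_one_left (norm_nonneg _) ht.2.le
    simp only [one_smul, zero_smul, sub_zero] at this
    rwa [norm_sub_rev]
  have h3 := le_of_tendsto ((h1.sub h2).norm) hbound
  rwa [le_div_iff₀' hξ] at h3

end Mollification

/-! ### Bounds for the rescaled symbol -/

/-- For `|ξ| > 2|η|` this is the mollification bound, invariant under dilation. For `|ξ| ≤ 2|η|`
boundedness of the symbol suffices: `2|η| · 2|C₂|`. -/
theorem exists_norm_mul_norm_symbol_sub_le (hreg : RegularSymbol w)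
    (hbdd : ∃ C : ℝ, ∀ᵐ ξ : Eu N, ‖symbol w ξ‖ ≤ C) :
    ∃ C : ℝ, 0 ≤ C ∧ ∀ η : Eu N, ∀ᵐ ξ : Eu N,
      ‖ξ‖ * ‖symbol w ξ - symbol w (ξ - η)‖ ≤ C * ‖η‖ := by
  obtain ⟨C₁, hC₁0, hC₁⟩ := norm_sub_le_of_weakDeriv hreg
  obtain ⟨C₂, hC₂⟩ := hbdd
  refine ⟨C₁ + 4 * |C₂|, by positivity, fun η => ?_⟩
  have h2 := (measurePreserving_sub_right volume η).quasiMeasurePreserving.ae hC₂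
  have h3 := (Measure.quasiMeasurePreserving_smul (volume : Measure (Eu N))
    (r := 2 * Real.pi) (by positivity)).ae (hC₁ ((2 * Real.pi) • η))
  have hpi : (0 : ℝ) < 2 * Real.pi := by positivity
  filter_upwards [hC₂, h2, h3] with ξ e1 e2 e3
  rcases lt_or_ge (2 * ‖η‖) ‖ξ‖ with h | h
  · have := e3 (by
      rw [norm_smul, norm_smul, Real.norm_of_nonneg hpi.le]
      nlinarith)
    rw [norm_smul, norm_smul, Real.norm_of_nonneg hpi.le, ← smul_sub] at this
    change _ * ‖symbol w ξ - symbol w (ξ - η)‖ ≤ _ at this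
    have h4 : ‖ξ‖ * ‖symbol w ξ - symbol w (ξ - η)‖ ≤ C₁ * ‖η‖ := by
      refine le_of_mul_le_mul_left ?_ hpi
      linarith
    have : 0 ≤ 4 * |C₂| * ‖η‖ := by positivity
    linarith
  · have h4 : ‖symbol w ξ - symbol w (ξ - η)‖ ≤ 2 * |C₂| := by
      have := norm_sub_le (symbol w ξ) (symbol w (ξ - η))
      have := le_abs_self C₂
      linarith
    calc _ ≤ (2 * ‖η‖) * (2 * |C₂|) := by gcongr
      _ ≤ _ := by
        have : 0 ≤ C₁ * ‖η‖ := by positivity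
        linarith

theorem fderiv_symbol (w : Eu N → ℂ) (ξ η : Eu N) :
    fderiv ℝ (symbol w) ξ η = (2 * Real.pi) • fderiv ℝ w ((2 * Real.pi) • ξ) η := by
  have : fderiv ℝ (symbol w) ξ = _ := fderiv_comp_smul (f := w) (2 * Real.pi) (x := ξ)
  rw [this]
  rfl

theorem ae_differentiableAt_symbol (hreg : RegularSymbol w) :
    ∀ᵐ ξ : Eu N, DifferentiableAt ℝ (symbol w) ξ := by
  have h := (Measure.quasiMeasurePreserving_smul (volume : Measure (Eu N))
    (r := 2 * Real.pi) (by positivity)).ae hreg.differentiable_ae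
  filter_upwards [h] with ξ hξ
  exact hξ.comp ξ (differentiableAt_id.const_smul (2 * Real.pi) :
    DifferentiableAt ℝ (fun ξ : Eu N => (2 * Real.pi) • ξ) ξ)

theorem exists_norm_mul_norm_fderiv_symbol_le (hreg : RegularSymbol w) :
    ∃ C : ℝ, 0 ≤ C ∧ ∀ᵐ ξ : Eu N, ∀ η : Eu N,
      ‖ξ‖ * ‖fderiv ℝ (symbol w) ξ η‖ ≤ C * ‖η‖ := by
  obtain ⟨C, hC0, hC⟩ := norm_mul_norm_fderiv_le hreg
  have hpi : (0 : ℝ) < 2 * Real.pi := by positivity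
  refine ⟨C, hC0, ?_⟩
  filter_upwards [(Measure.quasiMeasurePreserving_smul (volume : Measure (Eu N)) hpi.ne').ae hC]
    with ξ hξ η
  have := hξ η
  rw [norm_smul, Real.norm_of_nonneg hpi.le] at this
  rw [fderiv_symbol, norm_smul, Real.norm_of_nonneg hpi.le]
  linarith

theorem aestronglyMeasurable_fderiv_symbol (hreg : RegularSymbol w) (η : Eu N) :
    AEStronglyMeasurable (fun ξ => fderiv ℝ (symbol w) ξ η) volume := by
  have hsum : (fun ξ => fderiv ℝ (symbol w) ξ η) = fun ξ =>
      ∑ k, (2 * Real.pi) • η k • fderiv ℝ w ((2 * Real.pi) • ξ) (e k) := by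
    funext ξ
    rw [fderiv_symbol, fderiv_apply_eq_sum, Finset.smul_sum]
  rw [hsum]
  refine Finset.aestronglyMeasurable_fun_sum _ fun k _ => ?_
  have := aestronglyMeasurable_comp_smul
    (hreg.weakDeriv k).locallyIntegrable_deriv.aestronglyMeasurable
    (show (2 * Real.pi : ℝ) ≠ 0 by positivity)
  exact (this.const_smul (η k)).const_smul (2 * Real.pi)

/-! ### Weak derivatives against complex and Schwartz test functions -/

theorem IsWeakPartialDeriv.smooth_mul {j : Fin N} {f g a : Eu N → ℝ}
    (h : IsWeakPartialDeriv j f g) (ha : ContDiff ℝ ∞ a) :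
    IsWeakPartialDeriv j (fun x => a x * f x)
      (fun x => a x * g x + fderiv ℝ a x (e j) * f x) := by
  have hda : Continuous (fun x => fderiv ℝ a x (e j)) :=
    (ha.continuous_fderiv (by simp)).clm_apply continuous_const
  refine ⟨h.1.continuous_mul ha.continuous,
    (h.2.continuous_mul ha.continuous).add
      (h.1.continuous_mul hda), fun φ hφ hφc => ?_⟩
  have hd : ∀ x, fderiv ℝ (fun x => φ x * a x) x (e j) =
      φ x * fderiv ℝ a x (e j) + a x * fderiv ℝ φ x (e j) := fun x => by
    rw [fderiv_fun_mul (hφ.differentiable (by simp) x) (ha.differentiable (by simp) x)]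
    simp
  have h1 := h.integral_eq (fun x => φ x * a x) (hφ.mul ha) hφc.mul_right
  simp only [hd, smul_eq_mul] at h1 ⊢
  have i1 : Integrable (fun x => φ x * (fderiv ℝ a x (e j) * f x)) :=
    (h.1.continuous_mul hda).integrable_smul_left_of_hasCompactSupport
      hφ.continuous hφc
  have i2 : Integrable (fun x => φ x * (a x * g x)) :=
    (h.2.continuous_mul ha.continuous).integrable_smul_left_of_hasCompactSupport
      hφ.continuous hφc
  have i3 : Integrable (fun x => fderiv ℝ φ x (e j) * (a x * f x)) :=
    (h.1.continuous_mul ha.continuous).integrable_smul_left_of_hasCompactSupport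
      ((hφ.continuous_fderiv (by simp)).clm_apply continuous_const) (hφc.fderiv_apply ℝ (e j))
  have e1 : ∫ x, (φ x * fderiv ℝ a x (e j) + a x * fderiv ℝ φ x (e j)) * f x =
      (∫ x, φ x * (fderiv ℝ a x (e j) * f x)) + ∫ x, fderiv ℝ φ x (e j) * (a x * f x) := by
    rw [← integral_add i1 i3]
    congr 1 with x
    ring
  have e2 : ∫ x, φ x * (a x * g x + fderiv ℝ a x (e j) * f x) =
      (∫ x, φ x * (a x * g x)) + ∫ x, φ x * (fderiv ℝ a x (e j) * f x) := by
    rw [← integral_add i2 i1]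
    congr 1 with x
    ring
  rw [e1] at h1
  rw [e2]
  simp only [mul_assoc] at h1
  linarith

theorem IsWeakPartialDeriv.integral_complex {j : Fin N} {f g : Eu N → ℝ}
    (h : IsWeakPartialDeriv j f g) {φ : Eu N → ℂ} (hφ : ContDiff ℝ ∞ φ)
    (hφc : HasCompactSupport φ) :
    ∫ x, fderiv ℝ φ x (e j) * (f x : ℂ) = -∫ x, φ x * (g x : ℂ) := by
  -- Real test functions are recovered as `L ∘ φ`; `L = re` and `L = im` then give the complex
  -- identity.
  have key : ∀ L : ℂ →L[ℝ] ℝ, ∫ x, L (fderiv ℝ φ x (e j) * (f x : ℂ)) =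
      -∫ x, L (φ x * (g x : ℂ)) := fun L => by
    have h1 := h.integral_eq (fun x => L (φ x)) (L.contDiff.comp hφ)
      (hφc.comp_left (map_zero L))
    have hd : ∀ x, fderiv ℝ (fun x => L (φ x)) x (e j) = L (fderiv ℝ φ x (e j)) := fun x => by
      have := (L.hasFDerivAt.comp x (hφ.differentiable (by simp) x).hasFDerivAt).fderiv
      change fderiv ℝ (L ∘ φ) x (e j) = _
      rw [this]
      rfl
    have hL : ∀ (z : ℂ) (t : ℝ), L (z * t) = L z * t := fun z t => by
      rw [mul_comm, ← Complex.real_smul, map_smul, smul_eq_mul, mul_comm]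
    simp only [hd, smul_eq_mul] at h1
    simpa only [hL] using h1
  have hof : ∀ {u : Eu N → ℝ}, LocallyIntegrable u volume →
      LocallyIntegrable (fun x => (u x : ℂ)) volume := fun hu x => by
    obtain ⟨U, hU, hU'⟩ := hu x
    exact ⟨U, hU, hU'.ofReal⟩
  have i1 : Integrable (fun x => fderiv ℝ φ x (e j) * (f x : ℂ)) :=
    (hof h.1).integrable_smul_left_of_hasCompactSupport
      ((hφ.continuous_fderiv (by simp)).clm_apply continuous_const) (hφc.fderiv_apply ℝ (e j))
  have i2 : Integrable (fun x => φ x * (g x : ℂ)) :=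
    (hof h.2).integrable_smul_left_of_hasCompactSupport hφ.continuous hφc
  apply Complex.ext
  · have := key Complex.reCLM
    rw [Complex.reCLM.integral_comp_comm i1, Complex.reCLM.integral_comp_comm i2] at this
    simpa using this
  · have := key Complex.imCLM
    rw [Complex.imCLM.integral_comp_comm i1, Complex.imCLM.integral_comp_comm i2] at this
    simpa using this

theorem complexL2_coeFn {f : Eu N → ℝ} (hf : MemLp f 2 volume) :
    complexL2 hf =ᵐ[volume] fun x => (f x : ℂ) :=
  MemLp.coeFn_toLp _

theorem fderiv_comp_real_smul {F : Type*} [NormedAddCommGroup F] [NormedSpace ℝ F]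
    (θ : Eu N → F) (s : ℝ) (x v : Eu N) :
    fderiv ℝ (fun x => θ (s • x)) x v = s • fderiv ℝ θ (s • x) v := by
  rw [fderiv_comp_smul (f := θ) s]
  rfl

theorem tendsto_comp_smul {F : Type*} [TopologicalSpace F] {θ : Eu N → F} (hθ : Continuous θ)
    {s : ℕ → ℝ} (hs : Tendsto s atTop (𝓝 0)) (x : Eu N) :
    Tendsto (fun n => θ (s n • x)) atTop (𝓝 (θ 0)) := by
  have h1 : Tendsto (fun n => s n • x) atTop (𝓝 0) := by simpa using hs.smul_const x
  exact (hθ.tendsto 0).comp h1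

open LineDeriv in
-- Truncate `Ψ` by a bump dilated by `1 / s n`. The extra term from the Leibniz rule carries a
-- factor `s n` and vanishes in the limit.
theorem IsWeakPartialDeriv.integral_schwartz {j : Fin N} {f g : Eu N → ℝ}
    (h : IsWeakPartialDeriv j f g) (hf : MemLp f 2 volume) (hg : MemLp g 2 volume)
    (Ψ : 𝓢(Eu N, ℂ)) :
    ∫ x, complexL2 hf x * (∂_{e j} Ψ) x = -∫ x, complexL2 hg x * Ψ x := by
  let φ : ContDiffBump (0 : Eu N) := ⟨1, 2, one_pos, one_lt_two⟩
  have hφ : ContDiff ℝ ∞ φ := φ.contDiff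
  have hφd : Continuous (fun x => fderiv ℝ φ x (e j)) :=
    (hφ.continuous_fderiv (by simp)).clm_apply continuous_const
  have hφdc : HasCompactSupport (fun x => fderiv ℝ φ x (e j)) := φ.hasCompactSupport.fderiv_apply ℝ _
  obtain ⟨K, hK⟩ := hφdc.exists_bound_of_continuous hφd
  let s : ℕ → ℝ := fun n => 1 / ((n : ℝ) + 1)
  have hs : Tendsto s atTop (𝓝 0) := tendsto_one_div_add_atTop_nhds_zero_nat
  have hs0 : ∀ n, s n ≠ 0 := fun n => by positivity
  have hs1 : ∀ n, |s n| ≤ 1 := fun n => by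
    have : (0 : ℝ) ≤ n := n.cast_nonneg
    rw [abs_of_nonneg (by positivity)]
    exact (div_le_one (by positivity)).2 (by linarith)
  have hΨd : ∀ x, (∂_{e j} Ψ) x = fderiv ℝ Ψ x (e j) := fun x =>
    SchwartzMap.lineDerivOp_apply_eq_fderiv _ _ _
  have hφ1 : ∀ x, ‖(φ x : ℂ)‖ ≤ 1 := fun x => by
    rw [Complex.norm_real, Real.norm_of_nonneg φ.nonneg]
    exact φ.le_one
  have hφ0 : φ 0 = 1 := φ.one_of_mem_closedBall (by simp [φ])
  have key : ∀ n, (∫ x, (φ (s n • x) : ℂ) * ((∂_{e j} Ψ).toLp 2 volume x * complexL2 hf x)) +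
      (∫ x, ((s n * fderiv ℝ φ (s n • x) (e j) : ℝ) : ℂ) * (Ψ.toLp 2 volume x * complexL2 hf x)) =
      -∫ x, (φ (s n • x) : ℂ) * (Ψ.toLp 2 volume x * complexL2 hg x) := fun n => by
    have hφs : ContDiff ℝ ∞ (fun x => φ (s n • x)) := hφ.comp (contDiff_const_smul _)
    have hφs' : ContDiff ℝ ∞ (fun x => (φ (s n • x) : ℂ)) := Complex.ofRealCLM.contDiff.comp hφs
    have h1 := h.integral_complex (φ := fun x => (φ (s n • x) : ℂ) * Ψ x)
      (hφs'.mul Ψ.smooth')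
      (((φ.hasCompactSupport.comp_smul (hs0 n)).comp_left Complex.ofReal_zero).mul_right)
    have hd : ∀ x, fderiv ℝ (fun x => (φ (s n • x) : ℂ) * Ψ x) x (e j) =
        (φ (s n • x) : ℂ) * (∂_{e j} Ψ) x +
          ((s n * fderiv ℝ φ (s n • x) (e j) : ℝ) : ℂ) * Ψ x := fun x => by
      have e1 : fderiv ℝ (fun x => (φ (s n • x) : ℂ)) x (e j) =
          ((s n * fderiv ℝ φ (s n • x) (e j) : ℝ) : ℂ) := by
        rw [← smul_eq_mul, ← fderiv_comp_real_smul φ (s n) x (e j)]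
        have := (Complex.ofRealCLM.hasFDerivAt.comp x
          (hφs.differentiable (by simp) x).hasFDerivAt).fderiv
        change fderiv ℝ (Complex.ofRealCLM ∘ fun x => φ (s n • x)) x (e j) = _
        rw [this]
        rfl
      rw [fderiv_fun_mul (hφs'.differentiable (by simp) x) Ψ.differentiableAt]
      simp only [add_apply, smul_apply, smul_eq_mul, e1, hΨd]
      ring
    rw [← integral_add (integrable_mul_mul (K := 1) _ _ _ _)
      (integrable_mul_mul (K := |s n| * K) _ _ _ _)]
    · refine Eq.trans ?_ (h1.trans ?_)
      · refine integral_congr_ae ?_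
        filter_upwards [(∂_{e j} Ψ).coeFn_toLp 2 volume, Ψ.coeFn_toLp 2 volume,
          complexL2_coeFn hf] with x e1 e2 e3
        rw [e1, e2, e3, hd]
        ring
      · congr 1
        refine integral_congr_ae ?_
        filter_upwards [Ψ.coeFn_toLp 2 volume, complexL2_coeFn hg] with x e1 e2
        rw [e1, e2]
        ring
    · exact hφs'.continuous.aestronglyMeasurable
    · exact ae_of_all _ fun x => hφ1 _
    · exact (Complex.continuous_ofReal.comp (continuous_const.mul
        (hφd.comp (continuous_const_smul (s n))))).aestronglyMeasurable
    · refine ae_of_all _ fun x => ?_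
      rw [Complex.norm_real, norm_mul, Real.norm_eq_abs]
      gcongr
      exact hK _
  have hφsm : ∀ n, AEStronglyMeasurable (fun x : Eu N => (φ (s n • x) : ℂ)) volume := fun n =>
    (Complex.continuous_ofReal.comp
      (hφ.continuous.comp (continuous_const_smul (s n)))).aestronglyMeasurable
  have hφlim : ∀ᵐ x : Eu N, Tendsto (fun n => (φ (s n • x) : ℂ)) atTop (𝓝 1) :=
    ae_of_all _ fun x => by
      have := (Complex.continuous_ofReal.tendsto _).comp (tendsto_comp_smul hφ.continuous hs x)
      rwa [hφ0] at this
  have t1 := tendsto_integral_mul_mul hφsm (fun n => ae_of_all _ fun x => hφ1 _) hφlim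
    (tendsto_const_nhds (x := (∂_{e j} Ψ).toLp 2 volume)) (tendsto_const_nhds (x := complexL2 hf))
  have t3 := tendsto_integral_mul_mul hφsm (fun n => ae_of_all _ fun x => hφ1 _) hφlim
    (tendsto_const_nhds (x := Ψ.toLp 2 volume)) (tendsto_const_nhds (x := complexL2 hg))
  have t2 := tendsto_integral_mul_mul (μ := (volume : Measure (Eu N))) (K := K)
    (κ := fun n x => ((s n * fderiv ℝ φ (s n • x) (e j) : ℝ) : ℂ)) (κ' := fun _ => 0)
    (fun n => (Complex.continuous_ofReal.comp (continuous_const.mul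
        (hφd.comp (continuous_const_smul (s n))))).aestronglyMeasurable)
    (fun n => ae_of_all _ fun x => by
      rw [Complex.norm_real, norm_mul, Real.norm_eq_abs]
      exact (mul_le_of_le_one_left (norm_nonneg _) (hs1 n)).trans (hK _))
    (ae_of_all _ fun x => by
      have := (Complex.continuous_ofReal.tendsto _).comp (hs.mul (tendsto_comp_smul hφd hs x))
      rwa [zero_mul, Complex.ofReal_zero] at this)
    (tendsto_const_nhds (x := Ψ.toLp 2 volume)) (tendsto_const_nhds (x := complexL2 hf))
  have hfin := tendsto_nhds_unique (t1.add t2) (t3.neg.congr fun n => (key n).symm)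
  simp only [one_mul, zero_mul, integral_zero, add_zero] at hfin
  refine Eq.trans ?_ (hfin.trans ?_)
  · refine integral_congr_ae ?_
    filter_upwards [(∂_{e j} Ψ).coeFn_toLp 2 volume] with x e1
    rw [e1, mul_comm]
  · congr 1
    refine integral_congr_ae ?_
    filter_upwards [Ψ.coeFn_toLp 2 volume] with x e1
    rw [e1, mul_comm]

open LineDeriv in
/-- The Fourier transform of a weak derivative. -/
theorem IsWeakPartialDeriv.fourier_ae_eq {j : Fin N} {f g : Eu N → ℝ}
    (h : IsWeakPartialDeriv j f g) (hf : MemLp f 2 volume) (hg : MemLp g 2 volume) :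
    (𝓕 (complexL2 hg) : L2 N) =ᵐ[volume]
      fun ξ => (2 * Real.pi * Complex.I * (ξ j : ℂ)) * (𝓕 (complexL2 hf) : L2 N) ξ := by
  have hcont : Continuous (fun ξ : Eu N => 2 * Real.pi * Complex.I * (ξ j : ℂ)) := by fun_prop
  refine fourier_ae_eq_of_schwartz ((locallyIntegrable_coeFn_L2 _).continuous_mul hcont)
    fun ψ => ?_
  have htg : (fun x : Eu N => (inner ℝ x (e j) : ℝ)).HasTemperateGrowth := by fun_prop
  have h1 := h.integral_schwartz hf hg (𝓕 ψ)
  rw [SchwartzMap.lineDerivOp_fourier_eq, ← integral_fourier_mul] at h1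
  rw [← neg_eq_iff_eq_neg, ← integral_neg] at h1
  rw [← h1]
  congr 1 with ξ
  have hin : inner ℝ ξ (e j) = ξ j := by simp [e, EuclideanSpace.inner_single_right]
  simp [SchwartzMap.smulLeftCLM_apply_apply htg, hin]
  ring

/-! ### The commutator in Fourier variables -/

/-- The symbol `ξ_j (m(ξ) - m(ξ - c))`, where `m` is the symbol of `f ↦ W * f`. -/
def commSymbol (j : Fin N) (w : Eu N → ℂ) (c ξ : Eu N) : ℂ :=
  (ξ j : ℂ) * (symbol w ξ - symbol w (ξ - c))

/-- The quadratic form on `L²` with kernel `commSymbol j w c ξ` in the Fourier variables. -/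
def commForm (j : Fin N) (w : Eu N → ℂ) (c : Eu N) (F : L2 N) : ℂ :=
  ∫ ξ, commSymbol j w c ξ * (reflectLp c (𝓕 F : L2 N) ξ * (𝓕 F : L2 N) ξ)

theorem aestronglyMeasurable_commSymbol (hw : IsFourierTransform W w) (j : Fin N) (c : Eu N) :
    AEStronglyMeasurable (commSymbol j w c) volume := by
  have h1 : Continuous (fun ξ : Eu N => (ξ j : ℂ)) := by fun_prop
  have h2 := hw.aestronglyMeasurable_symbol
  exact h1.aestronglyMeasurable.mul
    (h2.sub (h2.comp_measurePreserving (measurePreserving_sub_right volume c)))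

/-- The smoothing of the commutator: the decay of `m(ξ) - m(ξ - c)` absorbs the factor `ξ_j` of the
derivative, at the price of one power of `c`. -/
theorem exists_ae_norm_commSymbol_le (hW : MemM22 W) (hw : IsFourierTransform W w)
    (hreg : RegularSymbol w) (j : Fin N) :
    ∃ C : ℝ, 0 ≤ C ∧ ∀ c : Eu N, ∀ᵐ ξ : Eu N, ‖commSymbol j w c ξ‖ ≤ C * ‖c‖ := by
  obtain ⟨C, hC0, hC⟩ := exists_norm_mul_norm_symbol_sub_le hreg (exists_ae_norm_symbol_le hW hw)
  refine ⟨C, hC0, fun c => ?_⟩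
  filter_upwards [hC c] with ξ hξ
  refine le_trans ?_ hξ
  rw [commSymbol, norm_mul, Complex.norm_real]
  gcongr
  exact PiLp.norm_apply_le ξ j

theorem norm_reflectLp (c : Eu N) (F : L2 N) : ‖reflectLp c F‖ = ‖F‖ :=
  Lp.norm_compMeasurePreserving F (Measure.measurePreserving_sub_left volume c)

theorem exists_norm_commForm_le (hW : MemM22 W) (hw : IsFourierTransform W w)
    (hreg : RegularSymbol w) (j : Fin N) :
    ∃ C : ℝ, 0 ≤ C ∧ ∀ (c : Eu N) (F : L2 N), ‖commForm j w c F‖ ≤ C * ‖c‖ * ‖F‖ ^ 2 := by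
  obtain ⟨C, hC0, hC⟩ := exists_ae_norm_commSymbol_le hW hw hreg j
  refine ⟨C, hC0, fun c F => ?_⟩
  refine (norm_integral_mul_mul_le (by positivity) (aestronglyMeasurable_commSymbol hw j c)
    (hC c) _ _).trans (le_of_eq ?_)
  rw [norm_reflectLp, Lp.norm_fourier_eq, sq]

theorem aestronglyMeasurable_commForm (hw : IsFourierTransform W w) (j : Fin N) (F : L2 N) :
    AEStronglyMeasurable (fun c => commForm j w c F) volume := by
  have hm := hw.aestronglyMeasurable_symbol
  have h1 : AEStronglyMeasurable (fun p : Eu N × Eu N => symbol w (p.2 - p.1))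
      (volume.prod volume) :=
    (hm.comp_quasiMeasurePreserving
      (quasiMeasurePreserving_sub (volume : Measure (Eu N)) volume)).prod_swap
  have h2 : AEStronglyMeasurable (fun p : Eu N × Eu N => symbol w p.2) (volume.prod volume) :=
    hm.comp_snd
  have h3 : Continuous (fun p : Eu N × Eu N => (p.2 j : ℂ)) := by fun_prop
  have hF := Lp.stronglyMeasurable (𝓕 F : L2 N)
  -- Joint measurability needs the pointwise expression: `reflectLp c` is only an a.e. class for
  -- each separate `c`.
  have h4 : StronglyMeasurable (fun p : Eu N × Eu N =>
      (𝓕 F : L2 N) (p.1 - p.2) * (𝓕 F : L2 N) p.2) :=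
    (hF.comp_measurable (measurable_fst.sub measurable_snd)).mul (hF.comp_measurable measurable_snd)
  have h5 := ((h3.aestronglyMeasurable.mul (h2.sub h1)).mul
    h4.aestronglyMeasurable).integral_prod_right'
  refine h5.congr (ae_of_all _ fun c => ?_)
  refine integral_congr_ae ?_
  filter_upwards [coeFn_reflectLp c (𝓕 F : L2 N)] with ξ hξ
  rw [hξ]
  rfl

theorem integrable_mul_L2 (u v : L2 N) : Integrable (fun x => u x * v x) :=
  (Lp.memLp u).integrable_mul (Lp.memLp v)

/-- Transform both products and substitute `ξ ↦ c - ξ` in the second. Both then contain `𝓕f(c - ξ)`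
and `𝓕g(ξ) = 2πi ξ_j 𝓕f(ξ)`, with coefficients `m(ξ)` and `m(c - ξ) = m(ξ - c)`. -/
theorem integral_character_commutator (hW : MemM22 W) (hw : IsFourierTransform W w)
    (heven : IsEven W) {j : Fin N} {f g : Eu N → ℝ} (h : IsWeakPartialDeriv j f g)
    (hf : MemLp f 2 volume) (hg : MemLp g 2 volume) (c : Eu N) :
    ∫ x, character c x * (complexL2 hf x * convL2 hW (complexL2 hg) x -
      complexL2 hg x * convL2 hW (complexL2 hf) x) =
    2 * Real.pi * Complex.I * commForm j w c (complexL2 hf) := by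
  set F := complexL2 hf
  set G := complexL2 hg
  have hc : Continuous (character c : Eu N → ℂ) :=
    continuous_character.comp (Continuous.prodMk_right c)
  have hi : ∀ u v : L2 N, Integrable (fun x => character c x * (u x * v x)) := fun u v =>
    integrable_mul_mul hc.aestronglyMeasurable (ae_of_all _ fun x => (norm_character c x).le) u v
  have hi' : ∀ u v : L2 N, Integrable (fun ξ => u (c - ξ) * v ξ) := fun u v => by
    refine (integrable_mul_L2 (reflectLp c u) v).congr ?_
    filter_upwards [coeFn_reflectLp c u] with ξ hξ
    rw [hξ]
  simp only [mul_sub]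
  rw [integral_sub (hi _ _) (hi _ _), integral_character_mul, integral_character_mul,
    ← integral_sub_left_eq_self (fun ξ => (𝓕 G : L2 N) (c - ξ) * _) volume c]
  simp only [sub_sub_cancel]
  rw [← integral_sub (hi' _ _) ((hi' _ _).congr (ae_of_all _ fun ξ => mul_comm _ _)), commForm,
    ← integral_const_mul]
  refine integral_congr_ae ?_
  have hrefl := (Measure.measurePreserving_sub_left (volume : Measure (Eu N))
    c).quasiMeasurePreserving
  have hsub := (measurePreserving_sub_right (volume : Measure (Eu N)) c).quasiMeasurePreserving
  filter_upwards [fourier_convL2 hW hw G, h.fourier_ae_eq hf hg,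
    hrefl.ae (fourier_convL2 hW hw F), hsub.ae (ae_symbol_neg heven hw),
    coeFn_reflectLp c (𝓕 F : L2 N)] with ξ e1 e2 e3 e4 e5
  rw [e1, e2, e3, e5, commSymbol, ← e4, neg_sub]
  ring

/-- Integration by parts together with `∂_j (W * f) = W * ∂_j f`: by Parseval the factor `2πi ξ_j`
moves between the two functions with a change of sign. -/
theorem integral_mul_convL2_weakDeriv (hW : MemM22 W) (hw : IsFourierTransform W w)
    {j : Fin N} {f g u u' : Eu N → ℝ} (h : IsWeakPartialDeriv j f g)
    (hf : MemLp f 2 volume) (hg : MemLp g 2 volume) (h' : IsWeakPartialDeriv j u u')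
    (hu : MemLp u 2 volume) (hu' : MemLp u' 2 volume) :
    ∫ x, complexL2 hu' x * convL2 hW (complexL2 hf) x =
      -∫ x, complexL2 hu x * convL2 hW (complexL2 hg) x := by
  rw [integral_mul_eq_fourier, integral_mul_eq_fourier, ← integral_neg]
  refine integral_congr_ae ?_
  filter_upwards [fourier_convL2 hW hw (complexL2 hf), h.fourier_ae_eq hf hg,
    fourier_convL2 hW hw (complexL2 hg),
    (Measure.measurePreserving_neg (volume : Measure (Eu N))).quasiMeasurePreserving.ae
      (h'.fourier_ae_eq hu hu')] with ξ e1 e2 e3 e4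
  rw [e1, e3, e2, e4]
  simp
  ring

/-! ### The commutator identity for a dilated cutoff -/

/-- Fourier inversion writes `b(s ·)` as a superposition of characters of frequency `s ζ`, reducing
a cutoff integral to those against characters. -/
theorem integral_comp_smul_mul (b : 𝓢(Eu N, ℂ)) (s : ℝ) {h : Eu N → ℂ} (hh : Integrable h) :
    ∫ x, b (s • x) * h x = ∫ ζ, (𝓕⁻ b) ζ * ∫ x, character (s • ζ) x * h x := by
  have hb : ∀ x, b (s • x) = ∫ ζ, character (s • ζ) x * (𝓕⁻ b) ζ := fun x => by
    have : (𝓕 (𝓕⁻ b)) (s • x) = b (s • x) := by rw [FourierTransform.fourier_fourierInv_eq]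
    rw [← this, fourier_apply_eq]
    congr 1 with ζ
    congr 1
    simp only [character, inner_smul_right, real_inner_comm x ζ]
  have hint : Integrable (Function.uncurry fun x ζ : Eu N =>
      h x * (𝓕⁻ b) ζ * character (s • ζ) x) (volume.prod volume) := by
    refine (hh.mul_prod (𝓕⁻ b).integrable).mul_bdd (c := 1) ?_ ?_
    · exact (continuous_character.comp
        ((continuous_snd.const_smul s).prodMk continuous_fst)).aestronglyMeasurable
    · exact ae_of_all _ fun p => (norm_character _ _).le
  calc ∫ x, b (s • x) * h x = ∫ x, ∫ ζ, h x * (𝓕⁻ b) ζ * character (s • ζ) x := by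
        congr 1 with x
        rw [hb, ← integral_mul_const]
        congr 1 with ζ
        ring
    _ = ∫ ζ, ∫ x, h x * (𝓕⁻ b) ζ * character (s • ζ) x := integral_integral_swap hint
    _ = _ := by
        congr 1 with ζ
        rw [← integral_const_mul]
        congr 1 with x
        ring

/-- Multiplication of an `L²_loc` function by a compactly supported continuous function. -/
theorem MemL2Loc.continuous_mul {g a : Eu N → ℝ} (hg : MemL2Loc g) (ha : Continuous a)
    (hac : HasCompactSupport a) : MemLp (fun x => a x * g x) 2 volume := by
  obtain ⟨K, hK⟩ := hac.exists_bound_of_continuous ha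
  have h1 : MemLp (fun x => a x * g x) 2 (volume.restrict (tsupport a)) :=
    (hg _ hac.isCompact).of_le_mul (c := K)
      (ha.aestronglyMeasurable.mul (hg _ hac.isCompact).aestronglyMeasurable)
      (ae_of_all _ fun x => by
        rw [norm_mul]
        gcongr
        exact hK x)
  rw [← memLp_indicator_iff_restrict (isClosed_tsupport a).measurableSet] at h1
  refine h1.ae_eq (ae_of_all _ fun x => ?_)
  by_cases hx : x ∈ tsupport a
  · rw [Set.indicator_of_mem hx]
  · rw [Set.indicator_of_notMem hx]
    simp [image_eq_zero_of_notMem_tsupport hx]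

theorem memLp_bdd_mul {f a : Eu N → ℝ} (hf : MemLp f 2 volume) (ha : Continuous a)
    {K : ℝ} (hK : ∀ x, ‖a x‖ ≤ K) : MemLp (fun x => a x * f x) 2 volume :=
  hf.of_le_mul (c := K) (ha.aestronglyMeasurable.mul hf.aestronglyMeasurable)
    (ae_of_all _ fun x => by
      rw [norm_mul]
      gcongr
      exact hK x)

theorem contDiff_comp_smul {b : Eu N → ℝ} (hb : ContDiff ℝ ∞ b) (s : ℝ) :
    ContDiff ℝ ∞ (fun x => b (s • x)) := hb.comp (contDiff_const_smul s)

theorem continuous_fderiv_apply {b : Eu N → ℝ} (hb : ContDiff ℝ ∞ b) (v : Eu N) :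
    Continuous (fun x => fderiv ℝ b x v) :=
  (hb.continuous_fderiv (by simp)).clm_apply continuous_const

theorem integrable_ofReal_mul_mul {κ : Eu N → ℝ} {K : ℝ} (hκ : Continuous κ)
    (hK : ∀ x, ‖κ x‖ ≤ K) (u v : L2 N) : Integrable (fun x => (κ x : ℂ) * (u x * v x)) :=
  integrable_mul_mul (Complex.continuous_ofReal.comp hκ).aestronglyMeasurable
    (ae_of_all _ fun x => (Complex.norm_real (κ x)).le.trans (hK x)) u v

/-- The identity `2 ∫ (W * f) a ∂_j f = - ∫ (W * f) (∂_j a) f - ∫ ∂_j f [W *, a] f` for `f ∈ H¹`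
and `a(x) = s⁻¹ b(s x)`, the commutator being written in the Fourier variables. -/
theorem commutator_identity_of_memLp (hW : MemM22 W) (hw : IsFourierTransform W w)
    (heven : IsEven W) {j : Fin N} {f g : Eu N → ℝ} (h : IsWeakPartialDeriv j f g)
    (hf : MemLp f 2 volume) (hg : MemLp g 2 volume) {b : Eu N → ℝ} (hb : ContDiff ℝ ∞ b)
    (hbc : HasCompactSupport b) {B : 𝓢(Eu N, ℂ)} (hB : ∀ x, B x = b x) {s : ℝ} (hs : s ≠ 0) :
    2 * (∫ x, ((s⁻¹ * b (s • x) * g x : ℝ) : ℂ) * convL2 hW (complexL2 hf) x) +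
      (∫ x, ((fderiv ℝ b (s • x) (e j) : ℝ) : ℂ) *
        (complexL2 hf x * convL2 hW (complexL2 hf) x)) =
    -∫ ζ, (𝓕⁻ B) ζ * ((s : ℂ)⁻¹ *
      (2 * Real.pi * Complex.I * commForm j w (s • ζ) (complexL2 hf))) := by
  set F := complexL2 hf
  set G := complexL2 hg
  have ha : ContDiff ℝ ∞ (fun x => s⁻¹ * b (s • x)) :=
    contDiff_const.mul (contDiff_comp_smul hb s)
  have hda : ∀ x, fderiv ℝ (fun x => s⁻¹ * b (s • x)) x (e j) = fderiv ℝ b (s • x) (e j) :=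
    fun x => by
      rw [fderiv_const_mul ((contDiff_comp_smul hb s).differentiable (by simp) x)]
      rw [smul_apply, fderiv_comp_real_smul, smul_smul, inv_mul_cancel₀ hs, one_smul]
  have hdb := continuous_fderiv_apply hb (e j)
  obtain ⟨K, hK⟩ := hbc.exists_bound_of_continuous hb.continuous
  obtain ⟨K', hK'⟩ := (hbc.fderiv_apply ℝ (e j)).exists_bound_of_continuous hdb
  have hda' : Continuous (fun x => fderiv ℝ b (s • x) (e j)) := hdb.comp (continuous_const_smul s)
  have hKa : ∀ x, ‖s⁻¹ * b (s • x)‖ ≤ ‖s⁻¹‖ * K := fun x => by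
    rw [norm_mul]
    gcongr
    exact hK _
  have hu := memLp_bdd_mul hf ha.continuous hKa
  have hu1 := memLp_bdd_mul hg ha.continuous hKa
  have hu2 := memLp_bdd_mul hf hda' fun x => hK' (s • x)
  have h' := h.smooth_mul ha
  simp only [hda] at h'
  have key := integral_mul_convL2_weakDeriv hW hw h hf hg h' hu (hu1.add hu2)
  have i1 : Integrable (fun x => ((s⁻¹ * b (s • x) : ℝ) : ℂ) * (G x * convL2 hW F x)) :=
    integrable_ofReal_mul_mul ha.continuous hKa _ _
  have i2 : Integrable (fun x => ((s⁻¹ * b (s • x) : ℝ) : ℂ) * (F x * convL2 hW G x)) :=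
    integrable_ofReal_mul_mul ha.continuous hKa _ _
  have i3 : Integrable (fun x => ((fderiv ℝ b (s • x) (e j) : ℝ) : ℂ) * (F x * convL2 hW F x)) :=
    integrable_ofReal_mul_mul hda' (fun x => hK' (s • x)) _ _
  have e0 : ∫ x, ((s⁻¹ * b (s • x) * g x : ℝ) : ℂ) * convL2 hW F x =
      ∫ x, ((s⁻¹ * b (s • x) : ℝ) : ℂ) * (G x * convL2 hW F x) := by
    refine integral_congr_ae ?_
    filter_upwards [complexL2_coeFn hg] with x e1
    rw [e1]
    push_cast
    ring
  have e1 : ∫ x, complexL2 (hu1.add hu2) x * convL2 hW F x =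
      (∫ x, ((s⁻¹ * b (s • x) : ℝ) : ℂ) * (G x * convL2 hW F x)) +
        ∫ x, ((fderiv ℝ b (s • x) (e j) : ℝ) : ℂ) * (F x * convL2 hW F x) := by
    rw [← integral_add i1 i3]
    refine integral_congr_ae ?_
    filter_upwards [complexL2_coeFn hg, complexL2_coeFn hf, complexL2_coeFn (hu1.add hu2)]
      with x e1 e2 e3
    rw [e1, e2, e3]
    simp only [Pi.add_apply]
    push_cast
    ring
  have e2 : ∫ x, complexL2 hu x * convL2 hW G x =
      ∫ x, ((s⁻¹ * b (s • x) : ℝ) : ℂ) * (F x * convL2 hW G x) := by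
    refine integral_congr_ae ?_
    filter_upwards [complexL2_coeFn hf, complexL2_coeFn hu] with x e1 e2
    rw [e1, e2]
    push_cast
    ring
  have e3 := integral_comp_smul_mul B s
    ((integrable_mul_L2 F (convL2 hW G)).sub (integrable_mul_L2 G (convL2 hW F)))
  simp only [Pi.sub_apply] at e3
  simp only [F, G, integral_character_commutator hW hw heven h hf hg] at e3
  -- With `a = s⁻¹ b(s ·)`, `key` reads `∫ a g (W * f) + ∫ ∂_j a f (W * f) = -∫ a f (W * g)`. Adding
  -- `∫ a g (W * f)` to both sides leaves minus this commutator.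
  have e4 : (∫ x, ((s⁻¹ * b (s • x) : ℝ) : ℂ) * (F x * convL2 hW G x)) -
      (∫ x, ((s⁻¹ * b (s • x) : ℝ) : ℂ) * (G x * convL2 hW F x)) =
      ∫ ζ, (𝓕⁻ B) ζ * ((s : ℂ)⁻¹ * (2 * Real.pi * Complex.I * commForm j w (s • ζ) F)) := by
    rw [← integral_sub i2 i1]
    calc _ = (s : ℂ)⁻¹ * ∫ x, B (s • x) * (F x * convL2 hW G x - G x * convL2 hW F x) := by
          rw [← integral_const_mul]
          congr 1 with x
          rw [hB]
          push_cast
          ring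
      _ = _ := by
          rw [e3, ← integral_const_mul]
          congr 1 with ζ
          ring
  rw [e1, e2] at key
  rw [e0, ← e4]
  linear_combination key

theorem tendsto_complexL2_mul {f : Eu N → ℝ} (hf : MemLp f 2 volume) {θ : ℕ → Eu N → ℝ}
    (hθ : ∀ n, Continuous (θ n)) (hθ1 : ∀ n x, ‖θ n x‖ ≤ 1)
    (hlim : ∀ x, Tendsto (fun n => θ n x) atTop (𝓝 1))
    (hm : ∀ n, MemLp (fun x => θ n x * f x) 2 volume) :
    Tendsto (fun n => complexL2 (hm n)) atTop (𝓝 (complexL2 hf)) := by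
  set F := complexL2 hf
  rw [tendsto_iff_norm_sub_tendsto_zero]
  have h1 := tendsto_integral_mul_mul (μ := (volume : Measure (Eu N)))
    (κ := fun n x => (((θ n x - 1) ^ 2 : ℝ) : ℂ)) (κ' := fun _ => 0) (K := 4)
    (fun n => (by have := hθ n; fun_prop : Continuous _).aestronglyMeasurable)
    (fun n => ae_of_all _ fun x => by
      have := abs_le.1 (hθ1 n x)
      rw [Complex.norm_real, Real.norm_of_nonneg (sq_nonneg _)]
      nlinarith)
    (ae_of_all _ fun x => by
      have := (Complex.continuous_ofReal.tendsto _).comp (((hlim x).sub_const 1).pow 2)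
      simpa [Function.comp_def] using this)
    (tendsto_const_nhds (x := star F)) (tendsto_const_nhds (x := F))
  -- The squared distance is `∫ (θ_n - 1)² |f|²`, with a weight at most `4` that tends to `0`.
  have h2 : ∀ n, ((‖complexL2 (hm n) - F‖ ^ 2 : ℝ) : ℂ) =
      ∫ x, (((θ n x - 1) ^ 2 : ℝ) : ℂ) * ((star F : L2 N) x * F x) := fun n => by
    have := inner_self_eq_norm_sq_to_K (𝕜 := ℂ) (complexL2 (hm n) - F)
    rw [L2.inner_def] at this
    push_cast
    refine Eq.trans this.symm ?_
    refine integral_congr_ae ?_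
    filter_upwards [Lp.coeFn_sub (complexL2 (hm n)) F, complexL2_coeFn (hm n), Lp.coeFn_star F,
      complexL2_coeFn hf] with x e1 e2 e3 e4
    change F x = _ at e4
    rw [e1, e3, Pi.sub_apply, Pi.star_apply, e2, e4, RCLike.inner_apply]
    simp
    ring
  simp only [← h2, zero_mul, integral_zero] at h1
  have h3 : Tendsto (fun n => ‖complexL2 (hm n) - F‖ ^ 2) atTop (𝓝 0) := by
    have := (Complex.continuous_re.tendsto 0).comp h1
    simpa only [Function.comp_def, Complex.ofReal_re, Complex.zero_re] using this
  have h4 := h3.sqrt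
  simpa using h4

theorem tendsto_fourier_L2 {ι : Type*} {l : Filter ι} {F : ι → L2 N} {F' : L2 N}
    (hF : Tendsto F l (𝓝 F')) :
    Tendsto (fun i => (𝓕 (F i) : L2 N)) l (𝓝 (𝓕 F' : L2 N)) :=
  ((Lp.fourierTransformₗᵢ (Eu N) ℂ).continuous.tendsto F').comp hF

theorem tendsto_commForm (hW : MemM22 W) (hw : IsFourierTransform W w)
    (hreg : RegularSymbol w) (j : Fin N) (c : Eu N) {F : ℕ → L2 N} {F' : L2 N}
    (hF : Tendsto F atTop (𝓝 F')) :
    Tendsto (fun n => commForm j w c (F n)) atTop (𝓝 (commForm j w c F')) := by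
  obtain ⟨C, -, hC⟩ := exists_ae_norm_commSymbol_le hW hw hreg j
  exact tendsto_integral_mul_mul (fun _ => aestronglyMeasurable_commSymbol hw j c)
    (fun _ => hC c) (ae_of_all _ fun _ => tendsto_const_nhds)
    (tendsto_reflectLp tendsto_const_nhds (tendsto_fourier_L2 hF)) (tendsto_fourier_L2 hF)

/-- The integrand of the Fourier representation of the commutator form `∫ ∂_j f [W *, a] f`,
where `a(x) = s⁻¹ b(s x)`. -/
def commIntegrand (j : Fin N) (w : Eu N → ℂ) (B : 𝓢(Eu N, ℂ)) (s : ℝ) (F : L2 N) (ζ : Eu N) : ℂ :=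
  (𝓕⁻ B) ζ * ((s : ℂ)⁻¹ * (2 * Real.pi * Complex.I * commForm j w (s • ζ) F))

theorem aestronglyMeasurable_commIntegrand (hw : IsFourierTransform W w) (j : Fin N)
    (B : 𝓢(Eu N, ℂ)) {s : ℝ} (hs : s ≠ 0) (F : L2 N) :
    AEStronglyMeasurable (commIntegrand j w B s F) volume :=
  (𝓕⁻ B).continuous.aestronglyMeasurable.mul (((aestronglyMeasurable_comp_smul
    (aestronglyMeasurable_commForm hw j F) hs).const_mul _).const_mul _)

/-- The factor `s⁻¹` cancels against the bound `C |s ζ|`. The majorant, uniform in `s`, is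
integrable since `𝓕⁻ B` is Schwartz; it serves for both limits, `F n → F` and `s → 0`. -/
theorem exists_norm_commIntegrand_le (hW : MemM22 W) (hw : IsFourierTransform W w)
    (hreg : RegularSymbol w) (j : Fin N) :
    ∃ C : ℝ, 0 ≤ C ∧ ∀ (B : 𝓢(Eu N, ℂ)) (s : ℝ), s ≠ 0 → ∀ (F : L2 N) (ζ : Eu N),
      ‖commIntegrand j w B s F ζ‖ ≤ C * ‖F‖ ^ 2 * (‖ζ‖ ^ 1 * ‖(𝓕⁻ B) ζ‖) := by
  obtain ⟨C, hC0, hC⟩ := exists_norm_commForm_le hW hw hreg j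
  refine ⟨2 * Real.pi * C, by positivity, fun B s hs F ζ => ?_⟩
  have h1 := hC (s • ζ) F
  have hs' : 0 < |s| := abs_pos.2 hs
  have hpi : ‖(2 * Real.pi * Complex.I : ℂ)‖ = 2 * Real.pi := by
    simp [abs_of_pos Real.pi_pos]
  rw [norm_smul, Real.norm_eq_abs] at h1
  rw [commIntegrand, norm_mul, norm_mul, norm_mul, hpi, norm_inv, Complex.norm_real,
    Real.norm_eq_abs]
  calc _ ≤ ‖(𝓕⁻ B) ζ‖ * (|s|⁻¹ * (2 * Real.pi * (C * (|s| * ‖ζ‖) * ‖F‖ ^ 2))) := by gcongr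
    _ = _ := by
        field_simp

/-- Apply the global case to `θ_n f`, with `θ_n` a widening cutoff. The derivative survives only as
`a g`, which is in `L²` because `a` has compact support; every other term is continuous in `f` for
the `L²` norm, and the terms in `∂_j θ_n` vanish. -/
theorem commutator_identity (hW : MemM22 W) (hw : IsFourierTransform W w)
    (heven : IsEven W) (hreg : RegularSymbol w) {j : Fin N} {f g : Eu N → ℝ}
    (h : IsWeakPartialDeriv j f g) (hf : MemLp f 2 volume) (hg : MemL2Loc g) {b : Eu N → ℝ}
    (hb : ContDiff ℝ ∞ b) (hbc : HasCompactSupport b) {B : 𝓢(Eu N, ℂ)} (hB : ∀ x, B x = b x)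
    {s : ℝ} (hs : s ≠ 0) :
    2 * (∫ x, ((s⁻¹ * b (s • x) * g x : ℝ) : ℂ) * convL2 hW (complexL2 hf) x) +
      (∫ x, ((fderiv ℝ b (s • x) (e j) : ℝ) : ℂ) *
        (complexL2 hf x * convL2 hW (complexL2 hf) x)) =
    -∫ ζ, commIntegrand j w B s (complexL2 hf) ζ := by
  let φ : ContDiffBump (0 : Eu N) := ⟨1, 2, one_pos, one_lt_two⟩
  have hφ : ContDiff ℝ ∞ φ := φ.contDiff
  have hφd := continuous_fderiv_apply hφ (e j)
  obtain ⟨K, hK⟩ := (φ.hasCompactSupport.fderiv_apply ℝ (e j)).exists_bound_of_continuous hφd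
  let r : ℕ → ℝ := fun n => 1 / ((n : ℝ) + 1)
  have hr : Tendsto r atTop (𝓝 0) := tendsto_one_div_add_atTop_nhds_zero_nat
  have hr0 : ∀ n, r n ≠ 0 := fun n => by positivity
  have hr1 : ∀ n, ‖r n‖ ≤ 1 := fun n => by
    have : (0 : ℝ) ≤ n := n.cast_nonneg
    rw [Real.norm_of_nonneg (by positivity)]
    exact (div_le_one (by positivity)).2 (by linarith)
  let θ : ℕ → Eu N → ℝ := fun n x => φ (r n • x)
  let θ' : ℕ → Eu N → ℝ := fun n x => r n • fderiv ℝ φ (r n • x) (e j)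
  have hθ : ∀ n, ContDiff ℝ ∞ (θ n) := fun n => contDiff_comp_smul hφ (r n)
  have hθc : ∀ n, HasCompactSupport (θ n) := fun n => φ.hasCompactSupport.comp_smul (hr0 n)
  have hθd : ∀ n x, fderiv ℝ (θ n) x (e j) = θ' n x := fun n x => fderiv_comp_real_smul φ _ x _
  have hθ' : ∀ n, Continuous (θ' n) := fun n =>
    (hφd.comp (continuous_const_smul (r n))).const_smul (r n)
  have hθ1 : ∀ n x, ‖θ n x‖ ≤ 1 := fun n x => by
    rw [Real.norm_of_nonneg φ.nonneg]
    exact φ.le_one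
  have hθ'K : ∀ n x, ‖θ' n x‖ ≤ K := fun n x => by
    rw [norm_smul]
    exact (mul_le_of_le_one_left (norm_nonneg _) (hr1 n)).trans (hK _)
  have hθlim : ∀ x, Tendsto (fun n => θ n x) atTop (𝓝 1) := fun x => by
    have := tendsto_comp_smul hφ.continuous hr x
    rwa [φ.one_of_mem_closedBall (by simp [φ])] at this
  have hθ'lim : ∀ x, Tendsto (fun n => θ' n x) atTop (𝓝 0) := fun x => by
    have := hr.smul (tendsto_comp_smul hφd hr x)
    rwa [zero_smul] at this
  have hfn : ∀ n, MemLp (fun x => θ n x * f x) 2 volume := fun n =>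
    memLp_bdd_mul hf (hθ n).continuous (hθ1 n)
  have hgn : ∀ n, MemLp (fun x => θ n x * g x + θ' n x * f x) 2 volume := fun n =>
    (hg.continuous_mul (hθ n).continuous (hθc n)).add (memLp_bdd_mul hf (hθ' n) (hθ'K n))
  have hweak : ∀ n, IsWeakPartialDeriv j (fun x => θ n x * f x)
      (fun x => θ n x * g x + θ' n x * f x) := fun n => by
    simpa only [hθd] using h.smooth_mul (hθ n)
  set F := complexL2 hf
  have hF := tendsto_complexL2_mul hf (fun n => (hθ n).continuous) hθ1 hθlim hfn
  have hFle : ∀ n, ‖complexL2 (hfn n)‖ ≤ ‖F‖ := fun n => by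
    refine Lp.norm_le_norm_of_ae_le ?_
    filter_upwards [complexL2_coeFn hf, complexL2_coeFn (hfn n)] with x e1 e2
    rw [e1, e2, Complex.norm_real, Complex.norm_real, norm_mul]
    exact mul_le_of_le_one_left (norm_nonneg _) (hθ1 n x)
  have hTF := ((convL2 hW).continuous.tendsto F).comp hF
  have ha : Continuous (fun x : Eu N => s⁻¹ * b (s • x)) :=
    continuous_const.mul (hb.continuous.comp (continuous_const_smul s))
  have hac : HasCompactSupport (fun x : Eu N => s⁻¹ * b (s • x)) :=
    (hbc.comp_smul hs).mul_left
  obtain ⟨Ka, hKa⟩ := hac.exists_bound_of_continuous ha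
  have hag := hg.continuous_mul ha hac
  have haf := memLp_bdd_mul hf ha hKa
  have hdb := continuous_fderiv_apply hb (e j)
  obtain ⟨K', hK'⟩ := (hbc.fderiv_apply ℝ (e j)).exists_bound_of_continuous hdb
  have hdb' : Continuous (fun x => fderiv ℝ b (s • x) (e j)) := hdb.comp (continuous_const_smul s)
  have key := fun n => commutator_identity_of_memLp hW hw heven (hweak n) (hfn n) (hgn n) hb hbc
    hB hs
  have hsplit : ∀ n, ∫ x, ((s⁻¹ * b (s • x) * (θ n x * g x + θ' n x * f x) : ℝ) : ℂ) *
      convL2 hW (complexL2 (hfn n)) x =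
      (∫ x, (θ n x : ℂ) * (complexL2 hag x * convL2 hW (complexL2 (hfn n)) x)) +
        ∫ x, (θ' n x : ℂ) * (complexL2 haf x * convL2 hW (complexL2 (hfn n)) x) := fun n => by
    rw [← integral_add (integrable_ofReal_mul_mul (hθ n).continuous (hθ1 n) _ _)
      (integrable_ofReal_mul_mul (hθ' n) (hθ'K n) _ _)]
    refine integral_congr_ae ?_
    filter_upwards [complexL2_coeFn hag, complexL2_coeFn haf] with x e1 e2
    rw [e1, e2]
    push_cast
    ring
  have hm : ∀ {κ : Eu N → ℝ}, Continuous κ →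
      AEStronglyMeasurable (fun x => (κ x : ℂ)) volume := fun hκ =>
    (Complex.continuous_ofReal.comp hκ).aestronglyMeasurable
  have t1 := tendsto_integral_mul_mul (fun n => hm (hθ n).continuous)
    (fun n => ae_of_all _ fun x => (Complex.norm_real _).le.trans (hθ1 n x))
    (ae_of_all _ fun x => (Complex.continuous_ofReal.tendsto _).comp (hθlim x))
    (tendsto_const_nhds (x := complexL2 hag)) hTF
  have t2 := tendsto_integral_mul_mul (fun n => hm (hθ' n))
    (fun n => ae_of_all _ fun x => (Complex.norm_real _).le.trans (hθ'K n x))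
    (ae_of_all _ fun x => (Complex.continuous_ofReal.tendsto _).comp (hθ'lim x))
    (tendsto_const_nhds (x := complexL2 haf)) hTF
  have t3 := tendsto_integral_mul_mul (fun n => hm hdb')
    (fun n => ae_of_all _ fun x => (Complex.norm_real _).le.trans (hK' (s • x)))
    (ae_of_all _ fun x => tendsto_const_nhds) hF hTF
  have t4 : Tendsto (fun n => ∫ ζ, commIntegrand j w B s (complexL2 (hfn n)) ζ) atTop
      (𝓝 (∫ ζ, commIntegrand j w B s F ζ)) := by
    obtain ⟨C, hC0, hC⟩ := exists_norm_commIntegrand_le hW hw hreg j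
    refine tendsto_integral_of_dominated_convergence
      (fun ζ => C * ‖F‖ ^ 2 * (‖ζ‖ ^ 1 * ‖(𝓕⁻ B) ζ‖))
      (fun n => aestronglyMeasurable_commIntegrand hw j B hs _)
      (((𝓕⁻ B).integrable_pow_mul volume 1).const_mul _)
      (fun n => ae_of_all _ fun ζ => (hC B s hs _ ζ).trans ?_) (ae_of_all _ fun ζ => ?_)
    · gcongr
      exact hFle n
    · exact ((tendsto_commForm hW hw hreg j (s • ζ) hF).const_mul _).const_mul _ |>.const_mul _
  have hfin := tendsto_nhds_unique (((t1.add t2).const_mul 2).add t3)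
    (t4.neg.congr fun n => by
      rw [Function.comp_apply, ← hsplit]
      exact (key n).symm)
  simp only [Complex.ofReal_one, one_mul, Complex.ofReal_zero, zero_mul, integral_zero,
    add_zero] at hfin
  rw [← hfin]
  congr 2
  refine integral_congr_ae ?_
  filter_upwards [complexL2_coeFn hag] with x e1
  rw [e1]

/-! ### Limit of the commutator as the cutoff widens -/

theorem tendsto_inv_mul_commSymbol {w : Eu N → ℂ} {ξ : Eu N}
    (h : DifferentiableAt ℝ (symbol w) ξ) (j : Fin N) (ζ : Eu N) :
    Tendsto (fun n : ℕ => (((n : ℝ)⁻¹ : ℝ) : ℂ)⁻¹ * commSymbol j w ((n : ℝ)⁻¹ • ζ) ξ) atTop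
      (𝓝 ((ξ j : ℂ) * fderiv ℝ (symbol w) ξ ζ)) := by
  -- The scale is `-n` because the increment is backward: `n (m(ξ) - m(ξ - ζ/n)) = -n (m(ξ - ζ/n) -
  -- m(ξ))`.
  have hc : Tendsto (fun n : ℕ => ‖-(n : ℝ)‖) atTop atTop := by
    simpa using tendsto_natCast_atTop_atTop (R := ℝ)
  have h1 := (h.hasFDerivAt.lim ζ hc).const_mul (ξ j : ℂ)
  refine h1.congr fun n => ?_
  rw [commSymbol, inv_neg, neg_smul, neg_smul, ← sub_eq_add_neg ξ]
  simp
  ring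

theorem ae_norm_inv_mul_commSymbol_le {j : Fin N} {C : ℝ} (hC0 : 0 ≤ C)
    (hC : ∀ c : Eu N, ∀ᵐ ξ : Eu N, ‖commSymbol j w c ξ‖ ≤ C * ‖c‖) (s : ℝ) (ζ : Eu N) :
    ∀ᵐ ξ : Eu N, ‖(s : ℂ)⁻¹ * commSymbol j w (s • ζ) ξ‖ ≤ C * ‖ζ‖ := by
  filter_upwards [hC (s • ζ)] with ξ hξ
  rw [norm_smul] at hξ
  rw [norm_mul, norm_inv, Complex.norm_real]
  -- The value `s = 0` occurs at `n = 0`, where `0⁻¹ = 0` makes the left side vanish.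
  rcases eq_or_ne s 0 with rfl | hs
  · simp
    positivity
  · have hs' : 0 < ‖s‖ := norm_pos_iff.2 hs
    calc ‖s‖⁻¹ * ‖commSymbol j w (s • ζ) ξ‖ ≤ ‖s‖⁻¹ * (C * (‖s‖ * ‖ζ‖)) := by gcongr
      _ = C * ‖ζ‖ := by field_simp

/-- The quadratic form on `L²` with symbol `ξ_j ∂_v m(ξ)`, where `m` is the symbol of
`f ↦ W * f`. -/
def derivForm (j : Fin N) (w : Eu N → ℂ) (F : L2 N) (v : Eu N) : ℂ :=
  ∫ ξ, ((ξ j : ℂ) * fderiv ℝ (symbol w) ξ v) * (reflectLp 0 (𝓕 F : L2 N) ξ * (𝓕 F : L2 N) ξ)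

theorem tendsto_inv_mul_commForm (hW : MemM22 W) (hw : IsFourierTransform W w)
    (hreg : RegularSymbol w) (j : Fin N) (F : L2 N) (ζ : Eu N) :
    Tendsto (fun n : ℕ => (((n : ℝ)⁻¹ : ℝ) : ℂ)⁻¹ * commForm j w ((n : ℝ)⁻¹ • ζ) F) atTop
      (𝓝 (derivForm j w F ζ)) := by
  obtain ⟨C, hC0, hC⟩ := exists_ae_norm_commSymbol_le hW hw hreg j
  have hlim : ∀ᵐ ξ : Eu N, Tendsto
      (fun n : ℕ => (((n : ℝ)⁻¹ : ℝ) : ℂ)⁻¹ * commSymbol j w ((n : ℝ)⁻¹ • ζ) ξ) atTop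
      (𝓝 ((ξ j : ℂ) * fderiv ℝ (symbol w) ξ ζ)) := by
    filter_upwards [ae_differentiableAt_symbol hreg] with ξ hξ
    exact tendsto_inv_mul_commSymbol hξ j ζ
  have hc : Tendsto (fun n : ℕ => (n : ℝ)⁻¹ • ζ) atTop (𝓝 0) := by
    simpa using (tendsto_inv_atTop_nhds_zero_nat (𝕜 := ℝ)).smul_const ζ
  have := tendsto_integral_mul_mul
    (fun n : ℕ => (aestronglyMeasurable_commSymbol hw j ((n : ℝ)⁻¹ • ζ)).const_mul
      ((((n : ℝ)⁻¹ : ℝ) : ℂ)⁻¹)) (fun n => ae_norm_inv_mul_commSymbol_le hC0 hC _ ζ) hlim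
    (tendsto_reflectLp hc (tendsto_const_nhds (x := (𝓕 F : L2 N))))
    (tendsto_const_nhds (x := (𝓕 F : L2 N)))
  refine this.congr fun n => ?_
  rw [commForm, ← integral_const_mul]
  simp only [mul_assoc]

theorem exists_ae_norm_mul_fderiv_symbol_le (hreg : RegularSymbol w) (j : Fin N) (v : Eu N) :
    ∃ C : ℝ, ∀ᵐ ξ : Eu N, ‖(ξ j : ℂ) * fderiv ℝ (symbol w) ξ v‖ ≤ C := by
  obtain ⟨C, -, hC⟩ := exists_norm_mul_norm_fderiv_symbol_le hreg
  refine ⟨C * ‖v‖, ?_⟩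
  filter_upwards [hC] with ξ hξ
  refine le_trans ?_ (hξ v)
  rw [norm_mul, Complex.norm_real]
  gcongr
  exact PiLp.norm_apply_le ξ j

theorem integrable_derivForm (hreg : RegularSymbol w) (j : Fin N) (v : Eu N) (u u' : L2 N) :
    Integrable (fun ξ => ((ξ j : ℂ) * fderiv ℝ (symbol w) ξ v) * (u ξ * u' ξ)) := by
  obtain ⟨C, hC⟩ := exists_ae_norm_mul_fderiv_symbol_le hreg j v
  have h1 : Continuous (fun ξ : Eu N => (ξ j : ℂ)) := by fun_prop
  exact integrable_mul_mul
    (h1.aestronglyMeasurable.mul (aestronglyMeasurable_fderiv_symbol hreg v)) hC u u'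

theorem derivForm_eq_sum (hreg : RegularSymbol w) (j : Fin N) (F : L2 N) (ζ : Eu N) :
    derivForm j w F ζ = ∑ k, (ζ k : ℂ) * derivForm j w F (e k) := by
  simp only [derivForm, ← integral_const_mul]
  rw [← integral_finsetSum _ fun k _ => (integrable_derivForm hreg j (e k) _ _).const_mul _]
  congr 1 with ξ
  rw [fderiv_apply_eq_sum, Finset.mul_sum, Finset.sum_mul]
  refine Finset.sum_congr rfl fun k _ => ?_
  rw [Complex.real_smul]
  ring

open LineDeriv in
-- First moments of `𝓕⁻ B` are derivatives of `B` at the origin: evaluate `∂_k B = 𝓕 (-2πi ζ_k 𝓕⁻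
-- B)` at `0`.
theorem integral_coord_mul_fourierInv (B : 𝓢(Eu N, ℂ)) (k : Fin N) :
    Integrable (fun ζ => (𝓕⁻ B) ζ * (2 * Real.pi * Complex.I * (ζ k : ℂ))) ∧
    ∫ ζ, (𝓕⁻ B) ζ * (2 * Real.pi * Complex.I * (ζ k : ℂ)) = -(∂_{e k} B) 0 := by
  have htg : (fun x : Eu N => (inner ℝ x (e k) : ℝ)).HasTemperateGrowth := by fun_prop
  have h1 : ∂_{e k} B = 𝓕 (-(2 * Real.pi * Complex.I) •
      SchwartzMap.smulLeftCLM ℂ (inner ℝ · (e k)) (𝓕⁻ B)) := by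
    rw [← SchwartzMap.lineDerivOp_fourier_eq, FourierTransform.fourier_fourierInv_eq]
  have h2 : ∀ ζ, (-(2 * Real.pi * Complex.I) •
      SchwartzMap.smulLeftCLM ℂ (inner ℝ · (e k)) (𝓕⁻ B)) ζ =
      -((𝓕⁻ B) ζ * (2 * Real.pi * Complex.I * (ζ k : ℂ))) := fun ζ => by
    have hin : inner ℝ ζ (e k) = ζ k := by simp [e, EuclideanSpace.inner_single_right]
    simp [SchwartzMap.smulLeftCLM_apply_apply htg, hin]
    ring
  constructor
  · refine (SchwartzMap.integrable (μ := volume) (-(2 * Real.pi * Complex.I) •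
      SchwartzMap.smulLeftCLM ℂ (inner ℝ · (e k)) (𝓕⁻ B))).neg.congr (ae_of_all _ fun ζ => ?_)
    rw [Pi.neg_apply, h2, neg_neg]
  · rw [h1, fourier_apply_eq, ← integral_neg]
    congr 1 with ζ
    rw [h2]
    simp [character]

open LineDeriv in
-- The limiting integrand is `𝓕⁻ B` times a linear form in `ζ`, so only first moments matter. They
-- give `-∑ ∂_k B(0) derivForm(e_k)`, and the condition on `B` selects `k = j`.
theorem tendsto_integral_commIntegrand (hW : MemM22 W) (hw : IsFourierTransform W w)
    (hreg : RegularSymbol w) (j : Fin N) (F : L2 N) {B : 𝓢(Eu N, ℂ)}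
    (hB : ∀ k, (∂_{e k} B) 0 = if k = j then 1 else 0) :
    Tendsto (fun n : ℕ => ∫ ζ, commIntegrand j w B (n : ℝ)⁻¹ F ζ) atTop
      (𝓝 (-derivForm j w F (e j))) := by
  obtain ⟨C, hC0, hC⟩ := exists_norm_commIntegrand_le hW hw hreg j
  have hs : ∀ᶠ n : ℕ in atTop, ((n : ℝ)⁻¹) ≠ 0 := by
    filter_upwards [eventually_ge_atTop 1] with n hn
    positivity
  have h1 : Tendsto (fun n : ℕ => ∫ ζ, commIntegrand j w B (n : ℝ)⁻¹ F ζ) atTop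
      (𝓝 (∫ ζ, (𝓕⁻ B) ζ * (2 * Real.pi * Complex.I * derivForm j w F ζ))) := by
    refine tendsto_integral_filter_of_dominated_convergence
      (fun ζ => C * ‖F‖ ^ 2 * (‖ζ‖ ^ 1 * ‖(𝓕⁻ B) ζ‖)) ?_ ?_
      (((𝓕⁻ B).integrable_pow_mul volume 1).const_mul _) (ae_of_all _ fun ζ => ?_)
    · filter_upwards [hs] with n hn
      exact aestronglyMeasurable_commIntegrand hw j B hn F
    · filter_upwards [hs] with n hn
      exact ae_of_all _ (hC B _ hn F)
    · refine (((tendsto_inv_mul_commForm hW hw hreg j F ζ).const_mul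
        (2 * Real.pi * Complex.I)).const_mul ((𝓕⁻ B) ζ)).congr fun n => ?_
      rw [commIntegrand]
      ring
  convert h1 using 2
  have h2 : ∀ ζ, (𝓕⁻ B) ζ * (2 * Real.pi * Complex.I * derivForm j w F ζ) =
      ∑ k, (𝓕⁻ B) ζ * (2 * Real.pi * Complex.I * (ζ k : ℂ)) * derivForm j w F (e k) :=
    fun ζ => by
      rw [derivForm_eq_sum hreg, Finset.mul_sum, Finset.mul_sum]
      exact Finset.sum_congr rfl fun k _ => by ring
  simp_rw [h2]
  rw [integral_finsetSum _ fun k _ => (integral_coord_mul_fourierInv B k).1.mul_const _]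
  simp_rw [integral_mul_const, (integral_coord_mul_fourierInv B _).2, hB]
  simp

theorem fourierL2_smul (F : L2 N) (ξ : Eu N) :
    fourierL2 F ((2 * Real.pi) • ξ) = (𝓕 F : L2 N) ξ := by
  rw [fourierL2, inv_smul_smul₀ (by positivity)]

/-- `derivForm` at the Fourier transform of a real function, in terms of `Ŵ` and `f̂`. -/
theorem derivForm_eq_integral (hreg : RegularSymbol w) (j : Fin N) {F : L2 N}
    (hF : ∀ᵐ x, starRingEnd ℂ (F x) = F x) :
    Integrable (fun ξ : Eu N => (ξ j : ℂ) * fderiv ℝ w ξ (e j) *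
      ((‖fourierL2 F ξ‖ ^ 2 : ℝ) : ℂ)) ∧
    derivForm j w F (e j) = 1 / (2 * (Real.pi : ℂ)) ^ N *
      ∫ ξ : Eu N, (ξ j : ℂ) * fderiv ℝ w ξ (e j) * ((‖fourierL2 F ξ‖ ^ 2 : ℝ) : ℂ) := by
  have hpi : (2 * Real.pi : ℝ) ≠ 0 := by positivity
  set Φ : Eu N → ℂ := fun ξ => (ξ j : ℂ) * fderiv ℝ w ξ (e j) * ((‖fourierL2 F ξ‖ ^ 2 : ℝ) : ℂ)
    with hΦ
  have h1 : (fun ξ => ((ξ j : ℂ) * fderiv ℝ (symbol w) ξ (e j)) *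
      (reflectLp 0 (𝓕 F : L2 N) ξ * (𝓕 F : L2 N) ξ)) =ᵐ[volume]
      fun ξ => Φ ((2 * Real.pi) • ξ) := by
    -- The operator `ξ_j ∂_j` is invariant under dilation, so passing from `m` to `w` costs only the
    -- Jacobian `(2π)^{-N}`.
    filter_upwards [fourier_conj_neg hF, coeFn_reflectLp 0 (𝓕 F : L2 N)] with ξ e1 e2
    rw [e2, zero_sub, e1, hΦ]
    simp only [fourierL2_smul, fderiv_symbol, PiLp.smul_apply, smul_eq_mul, Complex.real_smul]
    rw [mul_comm (starRingEnd ℂ _), Complex.mul_conj, Complex.normSq_eq_norm_sq]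
    push_cast
    ring
  constructor
  · exact (integrable_comp_smul_iff volume Φ hpi).1
      ((integrable_derivForm hreg j (e j) _ _).congr h1)
  · rw [derivForm, integral_congr_ae h1, Measure.integral_comp_smul volume Φ, Complex.real_smul,
      abs_of_nonneg (by positivity)]
    simp

/-! ### The cutoff `x_j χ(|x|)` -/

section Cutoff

variable {χ : ℝ → ℝ}

theorem contDiff_comp_norm (hχ : ContDiff ℝ ∞ χ) (hχ1 : ∀ t : ℝ, |t| < 1 → χ t = 1) :
    ContDiff ℝ ∞ (fun x : Eu N => χ ‖x‖) := by
  rw [contDiff_iff_contDiffAt]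
  intro x
  -- The norm is not smooth at `0`, but `χ ‖·‖` is constant near there.
  rcases eq_or_ne x 0 with rfl | hx
  · refine (contDiffAt_const (c := (1 : ℝ))).congr_of_eventuallyEq ?_
    filter_upwards [Metric.ball_mem_nhds (0 : Eu N) one_pos] with y hy
    exact hχ1 _ (by simpa using hy)
  · exact hχ.contDiffAt.comp x (contDiffAt_norm ℝ hx)

/-- The function `x ↦ x_j χ(|x|)`. -/
def coordCutoff (χ : ℝ → ℝ) (j : Fin N) (x : Eu N) : ℝ := x j * χ ‖x‖

theorem contDiff_coordCutoff (hχ : ContDiff ℝ ∞ χ) (hχ1 : ∀ t : ℝ, |t| < 1 → χ t = 1)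
    (j : Fin N) : ContDiff ℝ ∞ (coordCutoff χ j) :=
  (contDiff_euclidean.1 contDiff_id j).mul (contDiff_comp_norm hχ hχ1)

theorem hasCompactSupport_coordCutoff (hχ0 : ∀ t : ℝ, 2 < |t| → χ t = 0) (j : Fin N) :
    HasCompactSupport (coordCutoff χ j) := by
  refine HasCompactSupport.intro (isCompact_closedBall 0 2) fun x hx => ?_
  rw [coordCutoff, hχ0, mul_zero]
  simpa using hx

theorem fderiv_coordCutoff_zero (hχ1 : ∀ t : ℝ, |t| < 1 → χ t = 1) (j k : Fin N) :
    fderiv ℝ (coordCutoff χ j) 0 (e k) = if k = j then 1 else 0 := by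
  have h1 : coordCutoff χ j =ᶠ[𝓝 0] fun x : Eu N => EuclideanSpace.proj (𝕜 := ℝ) j x := by
    filter_upwards [Metric.ball_mem_nhds (0 : Eu N) one_pos] with y hy
    rw [coordCutoff, hχ1 _ (by simpa using hy), mul_one]
    rfl
  rw [h1.fderiv_eq, ContinuousLinearMap.fderiv]
  simp [e, eq_comm]

open LineDeriv in
theorem exists_schwartz_coordCutoff (hχ : ContDiff ℝ ∞ χ) (hχ1 : ∀ t : ℝ, |t| < 1 → χ t = 1)
    (hχ0 : ∀ t : ℝ, 2 < |t| → χ t = 0) (j : Fin N) :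
    ∃ B : 𝓢(Eu N, ℂ), (∀ x, B x = coordCutoff χ j x) ∧
      ∀ k, (∂_{e k} B) 0 = if k = j then 1 else 0 := by
  have hb := contDiff_coordCutoff (N := N) hχ hχ1 j
  have hbc : HasCompactSupport (fun x : Eu N => (coordCutoff χ j x : ℂ)) :=
    (hasCompactSupport_coordCutoff (N := N) hχ0 j).comp_left Complex.ofReal_zero
  refine ⟨hbc.toSchwartzMap (Complex.ofRealCLM.contDiff.comp hb), fun x => rfl, fun k => ?_⟩
  rw [SchwartzMap.lineDerivOp_apply_eq_fderiv]
  have h1 : fderiv ℝ (fun x : Eu N => (coordCutoff χ j x : ℂ)) 0 = _ :=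
    (Complex.ofRealCLM.hasFDerivAt.comp (0 : Eu N)
      (hb.differentiable (by simp) 0).hasFDerivAt).fderiv
  change fderiv ℝ (fun x : Eu N => (coordCutoff χ j x : ℂ)) 0 (e k) = _
  rw [h1]
  change ((fderiv ℝ (coordCutoff χ j) 0 (e k) : ℝ) : ℂ) = _
  rw [fderiv_coordCutoff_zero hχ1]
  split_ifs <;> simp

/-- Exhibits `x_j χ_n` as `s⁻¹ b(s x)` with `s = 1/n` and `b` independent of `n`, the form required
by the commutator identity. -/
theorem coordCutoff_smul (j : Fin N) {n : ℕ} (hn : 1 ≤ n) (x : Eu N) :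
    ((n : ℝ)⁻¹)⁻¹ * coordCutoff χ j ((n : ℝ)⁻¹ • x) = x j * χ (‖x‖ / n) := by
  have hn' : (0 : ℝ) < n := by exact_mod_cast hn
  rw [coordCutoff, norm_smul, Real.norm_of_nonneg (by positivity), PiLp.smul_apply, smul_eq_mul,
    div_eq_inv_mul]
  field_simp

end Cutoff

/-! ### Uniqueness of weak derivatives, and the conclusion -/

theorem IsWeakPartialDeriv.ae_eq {j : Fin N} {f g g' : Eu N → ℝ}
    (h : IsWeakPartialDeriv j f g) (h' : IsWeakPartialDeriv j f g') : g =ᵐ[volume] g' :=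
  ae_eq_of_integral_contDiff_smul_eq h.2 h'.2 fun φ hφ hφc => by
    rw [← neg_inj, ← h.integral_eq φ hφ hφc, h'.integral_eq φ hφ hφc]

theorem MemH1Loc.memL2Loc_weakDeriv {f : Eu N → ℝ} (hf : MemH1Loc f) {j : Fin N} {g : Eu N → ℝ}
    (h : IsWeakPartialDeriv j f g) : MemL2Loc g := fun K hK => by
  obtain ⟨g', hg', hg'2⟩ := hf.2 j
  exact (hg'2 K hK).ae_eq (ae_restrict_of_ae (hg'.ae_eq h))

end Pohozaev
end

theorem proposition5p3 {N : ℕ} (hN : 2 ≤ N)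
    (χ : ℝ → ℝ) (hχ : ContDiff ℝ ∞ χ)
    (hχ1 : ∀ t : ℝ, |t| < 1 → χ t = 1) (hχ0 : ∀ t : ℝ, 2 < |t| → χ t = 0)
    (W : 𝓢'(Pohozaev.Eu N, ℂ)) (hW : Pohozaev.MemM22 W)
    (hreal : Pohozaev.IsReal W) (heven : Pohozaev.IsEven W)
    (w : Pohozaev.Eu N → ℂ) (hw : Pohozaev.IsFourierTransform W w)
    (hreg : Pohozaev.RegularSymbol w)
    (f : Pohozaev.Eu N → ℝ) (hf : MemLp f 2 volume) (hf1 : Pohozaev.MemH1Loc f)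
    (j : Fin N) (Df : Pohozaev.Eu N → ℝ) (hDf : Pohozaev.IsWeakPartialDeriv j f Df) :
    (∀ n : ℕ, 1 ≤ n → Integrable (fun x : Pohozaev.Eu N =>
      Pohozaev.convL2 hW (Pohozaev.complexL2 hf) x *
        ((x j * χ (‖x‖ / n) * Df x : ℝ) : ℂ))) ∧
    Integrable (fun x : Pohozaev.Eu N =>
      Pohozaev.convL2 hW (Pohozaev.complexL2 hf) x * (f x : ℂ)) ∧
    Integrable (fun ξ : Pohozaev.Eu N => (ξ j : ℂ) * fderiv ℝ w ξ (Pohozaev.e j) *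
      ((‖Pohozaev.fourierL2 (Pohozaev.complexL2 hf) ξ‖ ^ 2 : ℝ) : ℂ)) ∧
    Tendsto
      (fun n : ℕ => -(1 / 2 : ℂ) * ∫ x : Pohozaev.Eu N,
        Pohozaev.convL2 hW (Pohozaev.complexL2 hf) x *
          ((x j * χ (‖x‖ / n) * Df x : ℝ) : ℂ))
      atTop
      (𝓝 ((1 / 4 : ℂ) * (∫ x : Pohozaev.Eu N,
            Pohozaev.convL2 hW (Pohozaev.complexL2 hf) x * (f x : ℂ))
          - 1 / (4 * (2 * (Real.pi : ℂ)) ^ N) *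
            ∫ ξ : Pohozaev.Eu N, (ξ j : ℂ) * fderiv ℝ w ξ (Pohozaev.e j) *
              ((‖Pohozaev.fourierL2 (Pohozaev.complexL2 hf) ξ‖ ^ 2 : ℝ) : ℂ))) := by
  open Pohozaev in
  set F := complexL2 hf
  have hFf : F =ᵐ[volume] fun x => (f x : ℂ) := complexL2_coeFn hf
  have hFreal : ∀ᵐ x, starRingEnd ℂ (F x) = F x := by
    filter_upwards [hFf] with x hx
    rw [hx, Complex.conj_ofReal]
  have hDf2 := hf1.memL2Loc_weakDeriv hDf
  have hb := contDiff_coordCutoff (N := N) hχ hχ1 j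
  have hbc := hasCompactSupport_coordCutoff (N := N) hχ0 j
  obtain ⟨B, hB, hBd⟩ := exists_schwartz_coordCutoff (N := N) hχ hχ1 hχ0 j
  have hFT : ∫ x, (1 : ℂ) * (F x * convL2 hW F x) = ∫ x, convL2 hW F x * (f x : ℂ) := by
    refine integral_congr_ae ?_
    filter_upwards [hFf] with x hx
    rw [hx, one_mul, mul_comm]
  have hterm : ∀ n : ℕ, 1 ≤ n → (fun x : Eu N => convL2 hW F x *
      ((x j * χ (‖x‖ / n) * Df x : ℝ) : ℂ)) = fun x =>
      ((((n : ℝ)⁻¹)⁻¹ * coordCutoff χ j ((n : ℝ)⁻¹ • x) * Df x : ℝ) : ℂ) * convL2 hW F x :=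
    fun n hn => by
      funext x
      rw [coordCutoff_smul j hn, mul_comm]
  refine ⟨fun n hn => ?_, ?_, (derivForm_eq_integral hreg j hFreal).1, ?_⟩
  · rw [hterm n hn]
    have hs : ((n : ℝ)⁻¹) ≠ 0 := by positivity
    have hag := hDf2.continuous_mul
      (a := fun x => ((n : ℝ)⁻¹)⁻¹ * coordCutoff χ j ((n : ℝ)⁻¹ • x))
      (continuous_const.mul (hb.continuous.comp (continuous_const_smul _)))
      ((hbc.comp_smul hs).mul_left)
    refine (integrable_mul_L2 (complexL2 hag) (convL2 hW F)).congr ?_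
    filter_upwards [complexL2_coeFn hag] with x hx
    rw [hx]
  · refine (integrable_mul_L2 (convL2 hW F) F).congr ?_
    filter_upwards [hFf] with x hx
    rw [hx]
  · have hdb := continuous_fderiv_apply hb (e j)
    obtain ⟨K, hK⟩ := (hbc.fderiv_apply ℝ (e j)).exists_bound_of_continuous hdb
    -- The weights `∂_j b(x/n)` are bounded and tend to `∂_j b(0) = 1`.
    have t1 := tendsto_integral_mul_mul (μ := (volume : Measure (Eu N))) (κ' := fun _ => 1)
      (κ := fun n x => ((fderiv ℝ (coordCutoff χ j) ((n : ℝ)⁻¹ • x) (e j) : ℝ) : ℂ))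
      (fun n => (Complex.continuous_ofReal.comp
        (hdb.comp (continuous_const_smul ((n : ℝ)⁻¹)))).aestronglyMeasurable)
      (fun n => ae_of_all _ fun x => (Complex.norm_real _).le.trans (hK _))
      (ae_of_all _ fun x => by
        have := (Complex.continuous_ofReal.tendsto _).comp
          (tendsto_comp_smul hdb (tendsto_inv_atTop_nhds_zero_nat (𝕜 := ℝ)) x)
        rwa [fderiv_coordCutoff_zero hχ1, if_pos rfl, Complex.ofReal_one] at this)
      (tendsto_const_nhds (x := F)) (tendsto_const_nhds (x := convL2 hW F))
    have t2 := tendsto_integral_commIntegrand hW hw hreg j F hBd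
    have t3 := (t1.const_mul (1 / 4)).add (t2.const_mul (1 / 4))
    rw [hFT, (derivForm_eq_integral hreg j hFreal).2] at t3
    have heq : ∀ A D : ℂ, 1 / 4 * A - 1 / (4 * (2 * (Real.pi : ℂ)) ^ N) * D =
        1 / 4 * A + 1 / 4 * -(1 / (2 * (Real.pi : ℂ)) ^ N * D) := fun A D => by
      have : (Real.pi : ℂ) ≠ 0 := by exact_mod_cast Real.pi_ne_zero
      field_simp
      ring
    rw [heq]
    refine t3.congr' ?_
    filter_upwards [eventually_ge_atTop 1] with n hn
    rw [hterm n hn]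
    -- A quarter of this identity expresses `-1/2 ∫ (W * f) x_j χ_n ∂_j f` as a quarter of the sum
    -- of the two convergent integrals.
    have := commutator_identity hW hw heven hreg hDf hf hDf2 hb hbc hB
      (s := (n : ℝ)⁻¹) (by positivity)
    linear_combination (1 / 4 : ℂ) * this
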